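/- Let $\mathfrak{sc}(2)$ be the (untwisted, Neveu–Schwarz) $N=2$ superconformal algebra over $\mathbb C$ with basis $L_m,T_m$ ($m\in\mathbb Z$), $G^\pm_r$ ($r\in\mathbb Z+\frac12$), $C$ ($C$ central) and $$[L_m,L_n]=(m-n)L_{m+n}+\tfrac{C}{12}(m^3-m)\delta_{m+n,0},\quad [L_m,G^\pm_r]=(\tfrac m2-r)G^\pm_{m+r},\quad [L_m,T_n]=-nT_{m+n},$$ $$[T_m,T_n]=\tfrac C3 m\,\delta_{m+n,0},\quad [T_m,G^\pm_r]=\pm G^\pm_{m+r},\quad \{G^+_r,G^-_s\}=2L_{r+s}+(r-s)T_{r+s}+\tfrac C3(r^2-\tfrac14)\delta_{r+s,0},$$ $\{G^+_r,G^+_s\}=\{G^-_r,G^-_s\}=0$. Let $V_{h,q,c}$ be the Verma module generated by $|h,q,c\rangle$, on which $L_0,T_0,C$ act by $h,q,c$ and all modes of positive index act by $0$. A vector $v\in V_{h,q,c}$ satisfies the highest weight conditions at grade $n$ with charge $p$ if $L_0v=(h+n)v$, $T_0v=(q+p)v$ and all modes of positive index annihilate $v$; it is singular if moreover it is not proportional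 to $|h,q,c\rangle$ (in particular $v\ne0$). Put $c(t)=3-3t$ and $h_{3,2}(t,q)=\frac{(2-3t)^2}{8t}-\frac{q^2}{2t}-\frac t8$. Consider $\Psi_{3,2}(t,q)=\Xi(t,q)\,|h_{3,2}(t,q),q,c(t)\rangle$, where $\Xi(t,q)=2^6(q+t)(q-t)\bigl(\cdots\bigr)$ with bracket $$\begin{aligned} &(q+t-1)\Bigl\{(q-t-1)(q-1)\bigl[t^3L_{-1}^3+t^4(t-1)L_{-3}+3t^2(q+1)L_{-1}^2T_{-1}-2t^3(q+1)L_{-2}T_{-1}\\ &\quad+t(3q^2+6q-t^2+3)L_{-1}T_{-1}^2-t^2(2qt+3q+4t+3)L_{-1}T_{-2}-2t^4L_{-2}L_{-1}+t^2(qt+2q+3t+2)(t+1)T_{-3}\\ &\quad-t(2q^2t+3q^2+6qt+6q-t^3-t^2+4t+3)T_{-2}T_{-1}\bigr]\\ &\quad+t^2(3q^2-2qt^2-3qt+2q+t^3+t^2-t-1)L_{-1}G^+_{-1/2}G^-_{-3/2}\\ &\quad+t(3q^3-2q^2t^2-3q^2t+3q^2+qt^3+qt^2-2qt-3q-t^4+5t^2+t-3)T_{-1}G^+_{-1/2}G^-_{-3/2}\\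 &\quad+t(q-t^2-2t+1)(q-t^2+1)(q-1)G^+_{-1/2}G^-_{-5/2}\Bigr\}\\ &+(q-t+1)\Bigl\{-t^2(3q^2+2qt^2+3qt-2q+t^3+t^2-t-1)L_{-1}G^+_{-3/2}G^-_{-1/2}\\ &\quad-t(3q^3+2q^2t^2+3q^2t-3q^2+qt^3+qt^2-2qt-3q+t^4-5t^2-t+3)T_{-1}G^+_{-3/2}G^-_{-1/2}\\ &\quad+t(q+t^2+2t-1)(q+t^2-1)(q+1)G^+_{-5/2}G^-_{-1/2}\Bigr\}\\ &+(q-t+1)(q+t-1)\Bigl\{-t(2q^2-t^4-t^3+2t^2-2)G^+_{-3/2}G^-_{-3/2}+(q+t+1)(q-t-1)(q+1)(q-1)T_{-1}^3\Bigr\}\\ &+6t^2q(q+1)(q-1)L_{-1}T_{-1}G^+_{-1/2}G^-_{-1/2}+t^3(3q^2-t^2+1)L_{-1}^2G^+_{-1/2}G^-_{-1/2}\\ &-2t^2(t-1)(t+1)(q+1)(q-1)L_{-2}G^+_{-1/2}G^-_{-1/2}+t(3q^4-6q^2+t^4-4t^2+3)T_{-1}^2G^+_{-1/2}G^-_{-1/2}\\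 &-t^2q(2q^2t+3q^2+t^3-6t-3)T_{-2}G^+_{-1/2}G^-_{-1/2}. \end{aligned}$$ For $t\in\mathbb C$ let $$\begin{aligned} \Delta_{01}(t)={}&4L_{-1}^3+12L_{-1}^2T_{-1}-2L_{-1}^2G^+_{-1/2}G^-_{-1/2}-8tL_{-2}L_{-1}+8L_{-1}T_{-1}^2-6L_{-1}T_{-1}G^+_{-1/2}G^-_{-1/2}\\ &-4(2t+5)L_{-1}T_{-2}+2(t-1)L_{-1}G^+_{-1/2}G^-_{-3/2}-8tL_{-2}T_{-1}+2(t+1)L_{-2}G^+_{-1/2}G^-_{-1/2}+4t(t-1)L_{-3}\\ &-4T_{-1}^2G^+_{-1/2}G^-_{-1/2}-4(t+4)T_{-2}T_{-1}+4tT_{-1}G^+_{-1/2}G^-_{-3/2}+(3t+5)T_{-2}G^+_{-1/2}G^-_{-1/2}\\ &+4(t+1)(t+4)T_{-3}-2(t-1)(t+1)G^+_{-1/2}G^-_{-5/2},\\ \Delta_{10}(t)={}&2L_{-1}^2G^+_{-1/2}G^-_{-1/2}-6L_{-1}T_{-1}G^+_{-1/2}G^-_{-1/2}-2(t-1)L_{-1}G^+_{-3/2}G^-_{-1/2}-2(t+1)L_{-2}G^+_{-1/2}G^-_{-1/2}\\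 &+4T_{-1}^2G^+_{-1/2}G^-_{-1/2}+4tT_{-1}G^+_{-3/2}G^-_{-1/2}+(3t+5)T_{-2}G^+_{-1/2}G^-_{-1/2}+2(t-1)(t+1)G^+_{-5/2}G^-_{-1/2}, \end{aligned}$$ $$\begin{aligned} \Theta^+(t,q)={}&2(2q^2+7qt+6t^2-1)G^+_{-5/2}-G^+_{-3/2}G^+_{-1/2}G^-_{-1/2}-2(2q+3t-1)L_{-1}G^+_{-3/2}+4(2q+3t)T_{-1}G^+_{-3/2}\\ &+2L_{-1}^2G^+_{-1/2}-6L_{-1}T_{-1}G^+_{-1/2}+4T_{-1}^2G^+_{-1/2}-2(q+2t+1)L_{-2}G^+_{-1/2}+(3q+6t+5)T_{-2}G^+_{-1/2},\\ \Theta^-(t,q)={}&2(2q-3t)(q-2t)G^-_{-5/2}-G^+_{-1/2}G^-_{-3/2}G^-_{-1/2}+2(2q-3t)L_{-1}G^-_{-3/2}+4(2q-3t)T_{-1}G^-_{-3/2}\\ &+2L_{-1}^2G^-_{-1/2}+6L_{-1}T_{-1}G^-_{-1/2}+4T_{-1}^2G^-_{-1/2}+2(q-2t)L_{-2}G^-_{-1/2}+(3q-6t-4)T_{-2}G^-_{-1/2}.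 \end{aligned}$$ Then: 1. For all $t\neq0$ and $q$, $\Psi_{3,2}(t,q)$ satisfies the highest weight conditions at grade $3$ with charge $0$. 2. $h_{3,2}(1,0)=0=c(1)$, so at $(t,q)=(1,0)$ the module is $V_{0,0,0}$; and $\Xi(1,0)=0$, so $\Psi_{3,2}$ vanishes identically there. 3. For every $t$, $\Xi(t,t-1)=2^6t^3(2t-1)(t-1)(t-2)\,\Delta_{01}(t)$ and $\Delta_{01}(t)=\Theta^-(t,t)\,G^+_{-1/2}$; for $t\ne0$, $h_{3,2}(t,t-1)=\frac{t-1}2$; and $\Delta_{01}(t)\,|\frac{t-1}2,t-1,3-3t\rangle$ is singular at grade $3$ with charge $0$ for every $t$. 4. For every $t$, $\Xi(t,1-t)=-2^6t^3(2t-1)(t-1)(t-2)\,\Delta_{10}(t)$ and $\Delta_{10}(t)=\Theta^+(t,-t)\,G^-_{-1/2}$; for $t\neq 0$, $h_{3,2}(t,1-t)=\frac{t-1}2$; and $\Delta_{10}(t)\,|\frac{t-1}2,1-t,3-3t\rangle$ is singular at grade $3$ with charge $0$ for every $t$. 5. For all $a,b\in\mathbb C$, the coefficientwise derivative of $\Xi$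 at $(1,0)$ is $(a\,\partial_t+b\,\partial_q)\Xi(1,0)=-32(a+b)\Delta_{01}(1)+32(a-b)\Delta_{10}(1)$; so along the line $q=t-1$ one obtains a nonzero multiple of $\Delta_{01}(1)$, along $q=1-t$ a nonzero multiple of $\Delta_{10}(1)$, and along any other direction a linear combination of the two. 6. $\Delta_{01}(1)|0,0,0\rangle$ and $\Delta_{10}(1)|0,0,0\rangle$ are linearly independent singular vectors of $V_{0,0,0}$, both at grade $3$ with charge $0$. 7. Consequently it is false that in every $N=2$ Verma module any two singular vectors of the same grade and the same charge are proportional, the uniqueness on which the previously conjectured $N=2$ embedding diagrams rest. -/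

import Mathlib

noncomputable section

namespace N2

/-- Basis of the (untwisted) N=2 superconformal algebra in the Neveu-Schwarz moding.
`Gp k` and `Gm k` are the odd generators `G⁺_{k+1/2}` and `G⁻_{k+1/2}`. -/
inductive Gen : Type
  | L (m : ℤ)
  | T (m : ℤ)
  | Gp (k : ℤ)
  | Gm (k : ℤ)
  | C

/-- A basis element, as an element of the free associative algebra on the basis
(that is, of the tensor algebra of the superalgebra). -/
abbrev fr (g : Gen) : FreeAlgebra ℂ Gen := FreeAlgebra.ι ℂ g

open Gen in
/-- The (anti-)commutation relations of the N=2 algebra. -/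
inductive Rel : FreeAlgebra ℂ Gen → FreeAlgebra ℂ Gen → Prop
  | LL (m n : ℤ) : Rel (fr (L m) * fr (L n) - fr (L n) * fr (L m))
      (((m : ℂ) - n) • fr (L (m + n)) +
        (if m + n = 0 then ((m : ℂ) ^ 3 - m) / 12 else 0) • fr C)
  | LGp (m k : ℤ) : Rel (fr (L m) * fr (Gp k) - fr (Gp k) * fr (L m))
      (((m : ℂ) / 2 - (k + 1 / 2)) • fr (Gp (m + k)))
  | LGm (m k : ℤ) : Rel (fr (L m) * fr (Gm k) - fr (Gm k) * fr (L m))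
      (((m : ℂ) / 2 - (k + 1 / 2)) • fr (Gm (m + k)))
  | LT (m n : ℤ) : Rel (fr (L m) * fr (T n) - fr (T n) * fr (L m))
      (-(n : ℂ) • fr (T (m + n)))
  | TT (m n : ℤ) : Rel (fr (T m) * fr (T n) - fr (T n) * fr (T m))
      ((if m + n = 0 then (m : ℂ) / 3 else 0) • fr C)
  | TGp (m k : ℤ) : Rel (fr (T m) * fr (Gp k) - fr (Gp k) * fr (T m)) (fr (Gp (m + k)))
  | TGm (m k : ℤ) : Rel (fr (T m) * fr (Gm k) - fr (Gm k) * fr (T m)) (-fr (Gm (m + k)))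
  | GpGm (k l : ℤ) : Rel (fr (Gp k) * fr (Gm l) + fr (Gm l) * fr (Gp k))
      ((2 : ℂ) • fr (L (k + l + 1)) + ((k : ℂ) - l) • fr (T (k + l + 1)) +
        (if k + l + 1 = 0 then (((k : ℂ) + 1 / 2) ^ 2 - 1 / 4) / 3 else 0) • fr C)
  | GpGp (k l : ℤ) : Rel (fr (Gp k) * fr (Gp l) + fr (Gp l) * fr (Gp k)) 0
  | GmGm (k l : ℤ) : Rel (fr (Gm k) * fr (Gm l) + fr (Gm l) * fr (Gm k)) 0
  | CC (g : Gen) : Rel (fr C * fr g) (fr g * fr C)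

/-- The universal enveloping algebra of the N=2 superconformal algebra. -/
abbrev U : Type := RingQuot Rel

/-- A basis element of the superalgebra in the universal enveloping algebra. -/
def gen (g : Gen) : U := RingQuot.mkAlgHom ℂ Rel (fr g)

/-- The left ideal generated by the positive modes and by `L₀ - h`, `T₀ - q`, `C - c`. -/
def vermaIdeal (h q c : ℂ) : Submodule U U :=
  Submodule.span U
    ({x | ∃ m : ℤ, 0 < m ∧ (x = gen (.L m) ∨ x = gen (.T m))} ∪
      {x | ∃ k : ℤ, 0 ≤ k ∧ (x = gen (.Gp k) ∨ x = gen (.Gm k))} ∪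
      {gen (.L 0) - algebraMap ℂ U h, gen (.T 0) - algebraMap ℂ U q,
        gen .C - algebraMap ℂ U c})

/-- The Verma module `V_{h,q,c}`, induced from the one-dimensional module of the Cartan
subalgebra plus the positive modes, as a quotient of the enveloping algebra. -/
abbrev Verma (h q c : ℂ) : Type := U ⧸ vermaIdeal h q c

/-- The highest weight vector `|h,q,c⟩`. -/
def hw (h q c : ℂ) : Verma h q c := Submodule.Quotient.mk 1

/-- `v` has grade `n` and charge `p` and is annihilated by all positive modes. -/
structure SatisfiesHW (h q c : ℂ) (n : ℚ) (p : ℤ) (v : Verma h q c) : Prop where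
  weight : gen (.L 0) • v = (h + (n : ℂ)) • v
  charge : gen (.T 0) • v = (q + (p : ℂ)) • v
  L_pos : ∀ m : ℤ, 0 < m → gen (.L m) • v = 0
  T_pos : ∀ m : ℤ, 0 < m → gen (.T m) • v = 0
  Gp_pos : ∀ k : ℤ, 0 ≤ k → gen (.Gp k) • v = 0
  Gm_pos : ∀ k : ℤ, 0 ≤ k → gen (.Gm k) • v = 0

/-- Singular vector of grade `n` and (relative) charge `p`: it satisfies the highest weight
conditions and is not proportional to the highest weight vector (so it is nonzero). -/
def IsSingular (h q c : ℂ) (n : ℚ) (p : ℤ) (v : Verma h q c) : Prop :=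
  SatisfiesHW h q c n p v ∧ ∀ a : ℂ, v ≠ a • hw h q c

/-- The uniqueness of singular vectors built into the conjectured embedding diagrams, in which
each weight occurs through a single embedded highest weight vector: in a Verma module two
singular vectors of the same grade and the same charge are proportional. -/
def SingularVectorsUnique : Prop :=
  ∀ (h q c : ℂ) (n : ℚ) (p : ℤ) (v w : Verma h q c),
    IsSingular h q c n p v → IsSingular h q c n p w → ∃ a : ℂ, w = a • v

/-- `c(t) = 3 - 3t`. -/
def cParam (t : ℂ) : ℂ := 3 - 3 * t

/-- `h_{r,s}(t,q)`. -/
def hParam (r s t q : ℂ) : ℂ := (s - r * t) ^ 2 / (8 * t) - q ^ 2 / (2 * t) - t / 8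

/-! Names of the negative modes: `L₁ = L_{-1}`, `T₁ = T_{-1}`, `P₁ = G⁺_{-1/2}`,
`P₃ = G⁺_{-3/2}`, `P₅ = G⁺_{-5/2}`, `M₁ = G⁻_{-1/2}`, and so on. -/

def L₁ : U := gen (.L (-1))
def L₂ : U := gen (.L (-2))
def L₃ : U := gen (.L (-3))
def T₁ : U := gen (.T (-1))
def T₂ : U := gen (.T (-2))
def T₃ : U := gen (.T (-3))
def P₁ : U := gen (.Gp (-1))
def P₃ : U := gen (.Gp (-2))
def P₅ : U := gen (.Gp (-3))
def M₁ : U := gen (.Gm (-1))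
def M₃ : U := gen (.Gm (-2))
def M₅ : U := gen (.Gm (-3))

/-- The operator of `Ψ_{3,2}` in the standard basis: each basis monomial with its coefficient,
a polynomial in `(t, q)`; the common factor `2⁶ (q+t)(q-t)` is supplied by `psi32` below. -/
def psi32Terms : List (U × (ℂ → ℂ → ℂ)) :=
  [ (L₁ ^ 3, fun t q => (q+t-1)*(q-t-1)*(q-1) * t^3),
    (L₃, fun t q => (q+t-1)*(q-t-1)*(q-1) * (t^4*(t-1))),
    (L₁ ^ 2 * T₁, fun t q => (q+t-1)*(q-t-1)*(q-1) * (3*t^2*(q+1))),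
    (L₂ * T₁, fun t q => (q+t-1)*(q-t-1)*(q-1) * (-2*t^3*(q+1))),
    (L₁ * T₁ ^ 2, fun t q => (q+t-1)*(q-t-1)*(q-1) * (t*(3*q^2+6*q-t^2+3))),
    (L₁ * T₂, fun t q => (q+t-1)*(q-t-1)*(q-1) * (-t^2*(2*q*t+3*q+4*t+3))),
    (L₂ * L₁, fun t q => (q+t-1)*(q-t-1)*(q-1) * (-2*t^4)),
    (T₃, fun t q => (q+t-1)*(q-t-1)*(q-1) * (t^2*(q*t+2*q+3*t+2)*(t+1))),
    (T₂ * T₁, fun t q => (q+t-1)*(q-t-1)*(q-1) *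
      (-t*(2*q^2*t+3*q^2+6*q*t+6*q-t^3-t^2+4*t+3))),
    (L₁ * P₁ * M₃, fun t q => (q+t-1) *
      (t^2*(3*q^2-2*q*t^2-3*q*t+2*q+t^3+t^2-t-1))),
    (T₁ * P₁ * M₃, fun t q => (q+t-1) *
      (t*(3*q^3-2*q^2*t^2-3*q^2*t+3*q^2+q*t^3+q*t^2-2*q*t-3*q-t^4+5*t^2+t-3))),
    (P₁ * M₅, fun t q => (q+t-1) * (t*(q-t^2-2*t+1)*(q-t^2+1)*(q-1))),
    (L₁ * P₃ * M₁, fun t q => (q-t+1) *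
      (-t^2*(3*q^2+2*q*t^2+3*q*t-2*q+t^3+t^2-t-1))),
    (T₁ * P₃ * M₁, fun t q => (q-t+1) *
      (-t*(3*q^3+2*q^2*t^2+3*q^2*t-3*q^2+q*t^3+q*t^2-2*q*t-3*q+t^4-5*t^2-t+3))),
    (P₅ * M₁, fun t q => (q-t+1) * (t*(q+t^2+2*t-1)*(q+t^2-1)*(q+1))),
    (P₃ * M₃, fun t q => (q-t+1)*(q+t-1) * (-t*(2*q^2-t^4-t^3+2*t^2-2))),
    (T₁ ^ 3, fun t q => (q-t+1)*(q+t-1) * ((q+t+1)*(q-t-1)*(q+1)*(q-1))),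
    (L₁ * T₁ * P₁ * M₁, fun t q => 6*t^2*q*(q+1)*(q-1)),
    (L₁ ^ 2 * P₁ * M₁, fun t q => t^3*(3*q^2-t^2+1)),
    (L₂ * P₁ * M₁, fun t q => -2*t^2*(t-1)*(t+1)*(q+1)*(q-1)),
    (T₁ ^ 2 * P₁ * M₁, fun t q => t*(3*q^4-6*q^2+t^4-4*t^2+3)),
    (T₂ * P₁ * M₁, fun t q => -t^2*q*(2*q^2*t+3*q^2+t^3-6*t-3)) ]

/-- The operator of `Ψ_{3,2}` at `(t,q)`:
`Ψ_{3,2}(t,q) = psi32 t q |h_{3,2}(t,q), q, c(t)⟩`. -/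
def psi32 (t q : ℂ) : U :=
  (psi32Terms.map fun x => (2 ^ 6 * (q + t) * (q - t) * x.2 t q) • x.1).sum

/-- Derivative of `psi32` at `(t₀,q₀)` in the direction `(a,b)`, that is
`a ∂/∂t + b ∂/∂q`, taken coefficientwise. -/
def psi32Deriv (t₀ q₀ a b : ℂ) : U :=
  (psi32Terms.map fun x =>
    deriv (fun s : ℂ => 2 ^ 6 * ((q₀ + s * b) + (t₀ + s * a)) * ((q₀ + s * b) - (t₀ + s * a)) *
      x.2 (t₀ + s * a) (q₀ + s * b)) 0 • x.1).sum

/-- The operator of the normalised `Δ_{3,2}(0,1)` on the line `q = t - 1`. -/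
def delta01 (t : ℂ) : U :=
  (4 : ℂ) • L₁ ^ 3 + (12 : ℂ) • (L₁ ^ 2 * T₁) - (2 : ℂ) • (L₁ ^ 2 * P₁ * M₁)
    - (8 * t) • (L₂ * L₁) + (8 : ℂ) • (L₁ * T₁ ^ 2) - (6 : ℂ) • (L₁ * T₁ * P₁ * M₁)
    - (4 * (2 * t + 5)) • (L₁ * T₂) + (2 * (t - 1)) • (L₁ * P₁ * M₃)
    - (8 * t) • (L₂ * T₁) + (2 * (t + 1)) • (L₂ * P₁ * M₁) + (4 * t * (t - 1)) • L₃
    - (4 : ℂ) • (T₁ ^ 2 * P₁ * M₁) - (4 * (t + 4)) • (T₂ * T₁) + (4 * t) • (T₁ * P₁ * M₃)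
    + (3 * t + 5) • (T₂ * P₁ * M₁) + (4 * (t + 1) * (t + 4)) • T₃
    - (2 * (t - 1) * (t + 1)) • (P₁ * M₅)

/-- The operator of the normalised `Δ_{3,2}(1,0)` on the line `q = 1 - t`. -/
def delta10 (t : ℂ) : U :=
  (2 : ℂ) • (L₁ ^ 2 * P₁ * M₁) - (6 : ℂ) • (L₁ * T₁ * P₁ * M₁)
    - (2 * (t - 1)) • (L₁ * P₃ * M₁) - (2 * (t + 1)) • (L₂ * P₁ * M₁)
    + (4 : ℂ) • (T₁ ^ 2 * P₁ * M₁) + (4 * t) • (T₁ * P₃ * M₁)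
    + (3 * t + 5) • (T₂ * P₁ * M₁) + (2 * (t - 1) * (t + 1)) • (P₅ * M₁)

/-- The singular vector operator `Θ⁺_{5/2}(t,q)` without its scalar prefactor. -/
def thetaPlus (t q : ℂ) : U :=
  (2 * (2 * q ^ 2 + 7 * q * t + 6 * t ^ 2 - 1)) • P₅ - P₃ * P₁ * M₁
    - (2 * (2 * q + 3 * t - 1)) • (L₁ * P₃) + (4 * (2 * q + 3 * t)) • (T₁ * P₃)
    + (2 : ℂ) • (L₁ ^ 2 * P₁) - (6 : ℂ) • (L₁ * T₁ * P₁) + (4 : ℂ) • (T₁ ^ 2 * P₁)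
    - (2 * (q + 2 * t + 1)) • (L₂ * P₁) + (3 * q + 6 * t + 5) • (T₂ * P₁)

/-- The singular vector operator `Θ⁻_{5/2}(t,q)` without its scalar prefactor. -/
def thetaMinus (t q : ℂ) : U :=
  (2 * (2 * q - 3 * t) * (q - 2 * t)) • M₅ - P₁ * M₃ * M₁
    + (2 * (2 * q - 3 * t)) • (L₁ * M₃) + (4 * (2 * q - 3 * t)) • (T₁ * M₃)
    + (2 : ℂ) • (L₁ ^ 2 * M₁) + (6 : ℂ) • (L₁ * T₁ * M₁) + (4 : ℂ) • (T₁ ^ 2 * M₁)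
    + (2 * (q - 2 * t)) • (L₂ * M₁) + (3 * q - 6 * t - 4) • (T₂ * M₁)

end N2

end

/-! Two separate problems have to be solved. That the given vectors satisfy the highest weight
conditions is a computation in a module over `U`. That two of them are nonzero and independent is a
statement about a quotient by a left ideal, so it needs a representation in which that ideal acts by
zero on a suitable vector while the two operators do not.

Annihilation. The modes G^±_{1/2} and T_1 generate all positive modes (`pos_smul_eq_zero`), so three
operators suffice. Their values on the 22 normally ordered monomials of grade 3 and charge 0 are
tabulated once, for an arbitrary weight (h, q, c). Each highest weight condition then becomes a list
of scalar identities in t and q (`psi32_isHW`, `delta01_isHW`, `delta10_isHW`).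

Nonvanishing. A PBW theorem is avoided by building a model of the Verma module by hand. On words in
the generators, a negative mode acts by concatenation and any other mode is commuted to the right
until it meets the empty word, where it acts by the character (h, q, c). By the Jacobi identity the
relations involving a non-negative mode hold exactly (`defect_nonneg`). Those among negative modes
hold modulo a subspace `negRel`, which is stable under every mode (`rho_mem`). So `U` acts on the
quotient, and the defining left ideal kills the empty word (`rep_vermaIdeal`). The quotient maps to
2×2 matrices through a representation of the negative modes in which only L_{-1} and G^±_{-1/2}
survive and generate a Clifford algebra (`cliffEval_negRel`). There Δ₀₁ becomes diag(0,4) and Δ₁₀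
becomes diag(4,0), which gives nonvanishing and independence together.

The failure of uniqueness appears at (t,q) = (1,0), where the family passes through zero: its
restrictions to the lines q = t-1 and q = 1-t both carry a factor t-1, and dividing it out leaves
two different limits. -/

noncomputable section

set_option linter.unusedSimpArgs false
set_option linter.unusedSectionVars false

namespace N2

/-! ### The superalgebra -/

/-- Parity of a basis element. -/
def Gen.odd : Gen → Bool
  | .Gp _ => true
  | .Gm _ => true
  | _ => false

/-- The sign `(-1)^{|x||y|}` of the super-commutator. -/
def sgn (x y : Gen) : ℂ := if x.odd && y.odd then -1 else 1

/-- The modes of negative index. -/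
def Gen.Neg : Gen → Prop
  | .L m => m < 0
  | .T m => m < 0
  | .Gp k => k < 0
  | .Gm k => k < 0
  | .C => False

open Finsupp in
/-- The super-commutator on basis elements. -/
def br : Gen → Gen → (Gen →₀ ℂ)
  | .L m, .L n => ((m : ℂ) - n) • single (.L (m + n)) 1 +
      (if m + n = 0 then ((m : ℂ) ^ 3 - m) / 12 else 0) • single .C 1
  | .L m, .T n => (-(n : ℂ)) • single (.T (m + n)) 1
  | .L m, .Gp k => ((m : ℂ) / 2 - (k + 1 / 2)) • single (.Gp (m + k)) 1
  | .L m, .Gm k => ((m : ℂ) / 2 - (k + 1 / 2)) • single (.Gm (m + k)) 1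
  | .T m, .L n => (m : ℂ) • single (.T (m + n)) 1
  | .T m, .T n => (if m + n = 0 then (m : ℂ) / 3 else 0) • single .C 1
  | .T m, .Gp k => single (.Gp (m + k)) 1
  | .T m, .Gm k => -single (.Gm (m + k)) 1
  | .Gp k, .L m => (-((m : ℂ) / 2 - (k + 1 / 2))) • single (.Gp (m + k)) 1
  | .Gp k, .T m => -single (.Gp (m + k)) 1
  | .Gp _, .Gp _ => 0
  | .Gp k, .Gm l => (2 : ℂ) • single (.L (k + l + 1)) 1 +
      ((k : ℂ) - l) • single (.T (k + l + 1)) 1 +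
      (if k + l + 1 = 0 then (((k : ℂ) + 1 / 2) ^ 2 - 1 / 4) / 3 else 0) • single .C 1
  | .Gm k, .L m => (-((m : ℂ) / 2 - (k + 1 / 2))) • single (.Gm (m + k)) 1
  | .Gm k, .T m => single (.Gm (m + k)) 1
  | .Gm l, .Gp k => (2 : ℂ) • single (.L (k + l + 1)) 1 +
      ((k : ℂ) - l) • single (.T (k + l + 1)) 1 +
      (if k + l + 1 = 0 then (((k : ℂ) + 1 / 2) ^ 2 - 1 / 4) / 3 else 0) • single .C 1
  | .Gm _, .Gm _ => 0
  | .C, _ => 0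
  | _, .C => 0

/-- The super-commutator with a basis element, as a linear map. -/
def ad (x : Gen) : (Gen →₀ ℂ) →ₗ[ℂ] (Gen →₀ ℂ) := Finsupp.linearCombination ℂ (br x)

/-- The super-commutator on the right with a basis element, as a linear map. -/
def adr (z : Gen) : (Gen →₀ ℂ) →ₗ[ℂ] (Gen →₀ ℂ) :=
  Finsupp.linearCombination ℂ (fun y => br y z)

@[simp] lemma ad_single (x y : Gen) : ad x (Finsupp.single y 1) = br x y := by simp [ad]
@[simp] lemma adr_single (z y : Gen) : adr z (Finsupp.single y 1) = br y z := by simp [adr]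

/-- The central terms survive only at opposite indices, and the polynomials m³-m and m are odd
there. The two orders of the mixed G-bracket are given by the same expression, since that bracket is
symmetric. -/
lemma br_symm (x y : Gen) : br x y = (-sgn x y) • br y x := by
  rcases x with m | m | m | m | _ <;> rcases y with n | n | n | n | _ <;>
    simp only [br, sgn, Gen.odd, Bool.and_true, Bool.and_false, Bool.false_eq_true, if_true,
      if_false, smul_zero, Int.add_comm, Bool.and_self]
  all_goals try module
  all_goals
    match_scalars
    all_goals try ring1
    all_goals
      split_ifs with h
      · obtain rfl : n = -m := by omega
        push_cast; ring
      · ring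

-- The super Jacobi identity in its derivation form: bracketing with x is a super-derivation. All
-- the coherence needed by the word model comes from it.
set_option maxHeartbeats 4000000 in
lemma jacobi (x y z : Gen) :
    ad x (br y z) = adr z (br x y) + sgn x y • ad y (br x z) := by
  rcases x with m | m | m | m | _ <;> rcases y with n | n | n | n | _ <;>
    rcases z with k | k | k | k | _ <;>
    simp only [br, sgn, Gen.odd, map_add, map_smul, map_neg, map_zero, ad_single, adr_single,
      Bool.and_true, Bool.and_false, Bool.false_eq_true, if_true, if_false, smul_zero, add_zero,
      zero_add, neg_zero, smul_add, neg_neg, smul_neg, one_smul, Bool.and_self]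
  all_goals try simp only [Int.add_assoc, Int.add_comm, Int.add_left_comm, Int.cast_add,
    Int.cast_one]
  all_goals try module
  all_goals
    match_scalars
    all_goals try ring1
    all_goals
      split_ifs with h
      -- What remains is the cocycle condition, nontrivial only when the true indices sum to zero.
      -- The second alternative is for triples with two G's, whose labels are each half a unit below
      -- the index.
      · obtain rfl | rfl : k = -m - n ∨ k = -m - n - 1 := by omega
        all_goals first | omega | (push_cast; ring1)
      · ring

section

/-! ### The module induced from a highest weight, on words in the generators -/

open Finsupp (supported linearCombination)

lemma sgn_comm (x y : Gen) : sgn x y = sgn y x := by simp [sgn, Bool.and_comm]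

lemma sgn_mul_self (x y : Gen) : sgn x y * sgn x y = 1 := by
  unfold sgn; split_ifs <;> norm_num

lemma br_mem_parity (x y : Gen) :
    br x y ∈ supported ℂ ℂ {g : Gen | g.odd = xor x.odd y.odd} := by
  cases x <;> cases y <;> simp only [br] <;>
    repeat' first
      | apply Submodule.zero_mem
      | apply Submodule.add_mem
      | apply Submodule.neg_mem
      | apply Submodule.smul_mem
      | exact Finsupp.single_mem_supported ℂ 1 rfl

lemma sgn_of_parity {g y z : Gen} (x : Gen) (hg : g.odd = xor y.odd z.odd) :
    sgn x g = sgn x y * sgn x z := by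
  unfold sgn
  rw [hg]
  cases x.odd <;> cases y.odd <;> cases z.odd <;> norm_num

/-- The negative modes form a subalgebra: two negative indices never sum to zero, so no central term
arises. -/
lemma br_mem_neg {x y : Gen} (hx : x.Neg) (hy : y.Neg) :
    br x y ∈ supported ℂ ℂ {g : Gen | g.Neg} := by
  cases x <;> cases y <;> simp only [Gen.Neg] at hx hy <;> simp only [br] <;>
    (try rw [if_neg (by omega), zero_smul]) <;>
    repeat' first
      | apply Submodule.zero_mem
      | apply Submodule.add_mem
      | apply Submodule.neg_mem
      | apply Submodule.smul_mem
      | (refine Finsupp.single_mem_supported ℂ 1 ?_; simp only [Gen.Neg, Set.mem_ofPred_eq]; omega)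

lemma br_mem_nonneg {x y : Gen} (hx : ¬ x.Neg) (hy : ¬ y.Neg) :
    br x y ∈ supported ℂ ℂ {g : Gen | ¬ g.Neg} := by
  cases x <;> cases y <;> simp only [Gen.Neg] at hx hy <;> simp only [br] <;>
    repeat' first
      | apply Submodule.zero_mem
      | apply Submodule.add_mem
      | apply Submodule.neg_mem
      | apply Submodule.smul_mem
      | (refine Finsupp.single_mem_supported ℂ 1 ?_; simp only [Gen.Neg, Set.mem_ofPred_eq]; omega)
      | exact Finsupp.single_mem_supported ℂ 1 not_false

/-- Induction over combinations of basis elements from a given set. -/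
lemma supported_induction {s : Set Gen} {p : (Gen →₀ ℂ) → Prop} {b : Gen →₀ ℂ}
    (hb : b ∈ supported ℂ ℂ s) (single : ∀ g ∈ s, p (Finsupp.single g 1)) (zero : p 0)
    (add : ∀ b b', p b → p b' → p (b + b')) (smul : ∀ (a : ℂ) b, p b → p (a • b)) : p b := by
  rw [Finsupp.supported_eq_span_single] at hb
  induction hb using Submodule.span_induction with
  | mem x hx => obtain ⟨g, hg, rfl⟩ := hx; exact single g hg
  | zero => exact zero
  | add x y _ _ hx hy => exact add x y hx hy
  | smul a x _ hx => exact smul a x hx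

/-- Words in the generators, the free associative algebra seen as a vector space. -/
abbrev Words : Type := List Gen →₀ ℂ

/-- Left multiplication of words by a generator. -/
def consL (y : Gen) : Words →ₗ[ℂ] Words := Finsupp.lmapDomain ℂ ℂ (List.cons y)

@[simp] lemma consL_single (y : Gen) (w : List Gen) (a : ℂ) :
    consL y (Finsupp.single w a) = Finsupp.single (y :: w) a := by simp [consL]

/-- The character of the non-negative modes that defines the Verma module. -/
def hwChar (h q c : ℂ) : Gen → ℂ
  | .L m => if m = 0 then h else 0
  | .T m => if m = 0 then q else 0
  | .Gp _ => 0
  | .Gm _ => 0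
  | .C => c

section

variable (h q c : ℂ)

open Classical in
/-- Action of a generator on a word: negative modes multiply from the left, the others are
commuted to the right. -/
def act : List Gen → Gen → Words
  | [], x => if x.Neg then Finsupp.single [x] 1 else hwChar h q c x • Finsupp.single [] 1
  | y :: w, x => if x.Neg then Finsupp.single (x :: y :: w) 1 else
      sgn x y • consL y (act w x) + linearCombination ℂ (act w) (br x y)

/-- Action of a generator on words, as a linear map. -/
def rho (x : Gen) : Words →ₗ[ℂ] Words := linearCombination ℂ (fun w => act h q c w x)

/-- Linear extension of `rho` to the superalgebra. -/
def rhoL : (Gen →₀ ℂ) →ₗ[ℂ] Words →ₗ[ℂ] Words := linearCombination ℂ (rho h q c)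

@[simp] lemma rhoL_single (x : Gen) : rhoL h q c (Finsupp.single x 1) = rho h q c x := by
  simp [rhoL]

lemma rho_neg {x : Gen} (hx : x.Neg) : rho h q c x = consL x := by
  ext1 w
  ext1
  cases w <;> simp [rho, act, hx]

lemma rho_nonneg_nil {x : Gen} (hx : ¬ x.Neg) :
    rho h q c x (Finsupp.single [] 1) = hwChar h q c x • Finsupp.single [] 1 := by
  simp [rho, act, hx]

lemma rhoL_apply_single (b : Gen →₀ ℂ) (w : List Gen) :
    rhoL h q c b (Finsupp.single w 1) = linearCombination ℂ (act h q c w) b := by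
  induction b using Finsupp.induction_linear with
  | zero => simp
  | add f g hf hg => simp [hf, hg]
  | single g a => simp [rhoL, rho]

/-- The defining recursion of `act`, extended from single words to combinations; from here on words
need not be inspected letter by letter. -/
lemma rho_cons {x : Gen} (hx : ¬ x.Neg) (y : Gen) (u : Words) :
    rho h q c x (consL y u) =
      sgn x y • consL y (rho h q c x u) + rhoL h q c (br x y) u := by
  induction u using Finsupp.induction_linear with
  | zero => simp
  | add f g hf hg => simp only [map_add, hf, hg, smul_add]; abel
  | single w a =>
    rw [← mul_one a, ← smul_eq_mul, ← Finsupp.smul_single]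
    simp only [map_smul, consL_single, rhoL_apply_single]
    rw [smul_comm (sgn x y) a, ← smul_add]
    congr 1
    simp [rho, act, hx]

/-! ### Super-commutation relations on words -/

/-- The defect of the super-commutation relation of `x` and `y` on `u`. -/
def defect (x y : Gen) (u : Words) : Words :=
  rho h q c x (rho h q c y u) - sgn x y • rho h q c y (rho h q c x u) - rhoL h q c (br x y) u

lemma defect_symm (x y : Gen) (u : Words) :
    defect h q c x y u = (-sgn x y) • defect h q c y x u := by
  have e := sgn_mul_self x y
  simp only [defect, br_symm x y, sgn_comm y x, map_smul, LinearMap.smul_apply]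
  linear_combination (norm := module) (-e) • rho h q c x (rho h q c y u)

variable {h q c}

/-- The second argument of the defect is extended linearly from generators to combinations. The sign
must be constant on the support, which holds for a bracket because brackets are homogeneous in
parity (`br_mem_sgn`). -/
lemma defect_left {N : Submodule ℂ Words} {x : Gen} {b : Gen →₀ ℂ} {s : ℂ} {u : Words}
    (H : ∀ g, defect h q c x g u ∈ N) (hb : b ∈ supported ℂ ℂ {g | sgn x g = s}) :
    rho h q c x (rhoL h q c b u) - s • rhoL h q c b (rho h q c x u)
      - rhoL h q c (ad x b) u ∈ N := by
  refine supported_induction (p := fun b => rho h q c x (rhoL h q c b u) -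
    s • rhoL h q c b (rho h q c x u) - rhoL h q c (ad x b) u ∈ N) hb ?_ ?_ ?_ ?_
  · rintro g rfl
    simpa [defect] using H g
  · simp
  · intro b b' hb hb'
    convert N.add_mem hb hb' using 1
    simp only [map_add, LinearMap.add_apply]
    module
  · intro a b hb
    convert N.smul_mem a hb using 1
    simp only [map_smul, LinearMap.smul_apply]
    module

lemma defect_right {N : Submodule ℂ Words} {x : Gen} {b : Gen →₀ ℂ} {s : ℂ} {u : Words}
    (H : ∀ g, defect h q c g x u ∈ N) (hb : b ∈ supported ℂ ℂ {g | sgn x g = s}) :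
    rhoL h q c b (rho h q c x u) - s • rho h q c x (rhoL h q c b u)
      - rhoL h q c (adr x b) u ∈ N := by
  refine supported_induction (p := fun b => rhoL h q c b (rho h q c x u) -
    s • rho h q c x (rhoL h q c b u) - rhoL h q c (adr x b) u ∈ N) hb ?_ ?_ ?_ ?_
  · rintro g rfl
    simpa [defect, sgn_comm x g] using H g
  · simp
  · intro b b' hb hb'
    convert N.add_mem hb hb' using 1
    simp only [map_add, LinearMap.add_apply]
    module
  · intro a b hb
    convert N.smul_mem a hb using 1
    simp only [map_smul, LinearMap.smul_apply]
    module

lemma br_mem_sgn (x y z : Gen) : br y z ∈ supported ℂ ℂ {g | sgn x g = sgn x y * sgn x z} :=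
  Finsupp.supported_mono (fun _ hg => sgn_of_parity x hg) (br_mem_parity y z)

lemma rhoL_cons {y : Gen} {b : Gen →₀ ℂ} {s : ℂ} (u : Words)
    (hb : b ∈ supported ℂ ℂ {g | sgn y g = s}) (hb' : b ∈ supported ℂ ℂ {g | ¬ g.Neg}) :
    rhoL h q c b (consL y u) = s • consL y (rhoL h q c b u) + rhoL h q c (adr y b) u := by
  have hb'' : b ∈ supported ℂ ℂ ({g | sgn y g = s} ∩ {g | ¬ g.Neg}) := by
    rw [Finsupp.supported_inter]; exact ⟨hb, hb'⟩
  refine supported_induction (p := fun b => rhoL h q c b (consL y u) =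
    s • consL y (rhoL h q c b u) + rhoL h q c (adr y b) u) hb'' ?_ ?_ ?_ ?_
  · rintro g ⟨rfl, hg⟩
    simpa [sgn_comm y g] using rho_cons h q c hg y u
  · simp
  · intro b b' hb hb'
    simp only [map_add, LinearMap.add_apply, hb, hb']
    module
  · intro a b hb
    simp only [map_smul, LinearMap.smul_apply, hb]
    module

/-- The weight data define a one-dimensional representation of the non-negative modes. A zero mode
or central term can arise only from two modes of index zero, and there its coefficient vanishes; two
positive G-modes have an index sum of at least one. -/
lemma hwChar_br {x y : Gen} (hx : ¬ x.Neg) (hy : ¬ y.Neg) :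
    rhoL h q c (br x y) (Finsupp.single [] 1) = 0 := by
  have H : rhoL h q c (br x y) (Finsupp.single [] 1) =
      linearCombination ℂ (hwChar h q c) (br x y) • Finsupp.single [] 1 := by
    refine supported_induction (p := fun b => rhoL h q c b (Finsupp.single [] 1) =
      linearCombination ℂ (hwChar h q c) b • Finsupp.single [] 1) (br_mem_nonneg hx hy) ?_ ?_ ?_ ?_
    · intro g hg
      simp [rho_nonneg_nil h q c hg]
    · simp
    · intro b b' hb hb'
      simp only [map_add, LinearMap.add_apply, hb, hb', add_smul]
    · intro a b hb
      simp only [map_smul, LinearMap.smul_apply, hb, smul_assoc]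
  rw [H]
  suffices linearCombination ℂ (hwChar h q c) (br x y) = 0 by rw [this, zero_smul]
  cases x <;> cases y <;> simp only [Gen.Neg] at hx hy <;>
    simp only [br, map_add, map_smul, map_neg, map_zero, Finsupp.linearCombination_single,
      hwChar, neg_zero, smul_eq_mul, mul_zero]
  case L.L m n =>
    by_cases hm : m = 0
    · obtain rfl := hm
      by_cases hn : n = 0 <;> simp [hn]
    · simp [show m + n ≠ 0 by omega]
  case L.T m n =>
    by_cases hn : n = 0
    · simp [hn]
    · simp [show m + n ≠ 0 by omega]
  case T.L m n =>
    by_cases hm : m = 0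
    · simp [hm]
    · simp [show m + n ≠ 0 by omega]
  case T.T m n =>
    by_cases hm : m = 0
    · simp [hm]
    · simp [show m + n ≠ 0 by omega]
  case Gp.Gm m n => simp [show m + n + 1 ≠ 0 by omega]
  case Gm.Gp m n => simp [show n + m + 1 ≠ 0 by omega]

/-- For negative z this is the recursion defining the action. For non-negative z, both modes are
moved past the first letter, and Jacobi reduces the defect to defects on the shorter word. -/
lemma defect_nonneg {x : Gen} (hx : ¬ x.Neg) (z : Gen) (u : Words) : defect h q c x z u = 0 := by
  by_cases hz : z.Neg
  · rw [defect, rho_neg h q c hz, rho_cons h q c hx]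
    abel
  have hw : ∀ (w : List Gen) (x z : Gen), ¬ x.Neg → ¬ z.Neg →
      defect h q c x z (Finsupp.single w 1) = 0 := by
    intro w
    induction w with
    | nil =>
      intro x z hx hz
      rw [defect, hwChar_br hx hz]
      simp only [rho_nonneg_nil h q c hx, rho_nonneg_nil h q c hz, map_smul]
      -- The sign is -1 only for two odd modes, and the character vanishes on odd modes.
      have e : (sgn x z - 1) * (hwChar h q c x * hwChar h q c z) = 0 := by
        cases x <;> cases z <;> simp [hwChar, sgn, Gen.odd]
      linear_combination (norm := module) (-e) • (Finsupp.single [] 1 : Words)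
    | cons y w ih =>
      intro x z hx hz
      -- The brackets of x and z with the letter y may contain negative modes, so the induction
      -- hypothesis is needed for an arbitrary second argument.
      have ih' : ∀ x, ¬ x.Neg → ∀ z, defect h q c x z (Finsupp.single w 1) ∈
          (⊥ : Submodule ℂ Words) := by
        intro x hx z
        rw [Submodule.mem_bot]
        by_cases hz : z.Neg
        · rw [defect, rho_neg h q c hz, rho_cons h q c hx]
          abel
        · exact ih x z hx hz
      have e1 := (Submodule.mem_bot ℂ).1 (defect_left (ih' x hx) (br_mem_sgn x z y))
      have e2 := (Submodule.mem_bot ℂ).1 (defect_left (ih' z hz) (br_mem_sgn z x y))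
      have e3 := rhoL_cons (h := h) (q := q) (c := c) (Finsupp.single w 1) (br_mem_sgn y x z)
        (br_mem_nonneg hx hz)
      have e4 := congrArg (consL y) (ih x z hx hz)
      have e5 := congrArg (fun b => rhoL h q c b (Finsupp.single w 1)) (jacobi x z y)
      have e6 := sgn_mul_self x z
      rw [← consL_single]
      simp only [defect, rho_cons h q c hx, rho_cons h q c hz, map_add, map_smul, map_sub,
        LinearMap.add_apply, LinearMap.smul_apply, map_zero, sgn_comm z x, sgn_comm y x,
        sgn_comm y z, e3] at *
      linear_combination (norm := module) e1 - sgn x z • e2 + (sgn x y * sgn z y) • e4 + e5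
        - (sgn z y • e6) • rhoL h q c (br x y) (rho h q c z (Finsupp.single w 1))
  induction u using Finsupp.induction_linear with
  | zero => simp [defect]
  | add f g hf hg =>
    simp only [defect, map_add, smul_add] at *
    linear_combination (norm := module) hf + hg
  | single w a =>
    have := hw w x z hx hz
    rw [← mul_one a, ← smul_eq_mul, ← Finsupp.smul_single]
    simp only [defect, map_smul] at *
    linear_combination (norm := module) a • this

/-! ### Relations among negative modes and their stability -/

variable (h q c) in
/-- Generators of the relations among negative modes, closed under left multiplication. -/
inductive NegRel : Words → Prop
  | rel (x y : Gen) (hx : x.Neg) (hy : y.Neg) (u : Words) : NegRel (defect h q c x y u)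
  | cons (y : Gen) (u : Words) : NegRel u → NegRel (consL y u)

variable (h q c) in
/-- The relations among negative modes. -/
def negRel : Submodule ℂ Words := Submodule.span ℂ {u | NegRel h q c u}

/-- If at least one mode is non-negative the defect is zero, after exchanging the two if necessary;
otherwise it is a generator of `negRel`. -/
lemma defect_mem (x y : Gen) (u : Words) : defect h q c x y u ∈ negRel h q c := by
  by_cases hx : x.Neg
  · by_cases hy : y.Neg
    · exact Submodule.subset_span (.rel x y hx hy u)
    · rw [defect_symm, defect_nonneg hy, smul_zero]
      exact Submodule.zero_mem _
  · rw [defect_nonneg hx]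
    exact Submodule.zero_mem _

lemma consL_mem (y : Gen) {u : Words} (hu : u ∈ negRel h q c) : consL y u ∈ negRel h q c := by
  have : negRel h q c ≤ (negRel h q c).comap (consL y) :=
    Submodule.span_le.2 fun u hu => Submodule.subset_span (.cons y u hu)
  exact this hu

/-- Moving a non-negative x through the defect of y and z leaves, by Jacobi, the defects of (y, z),
of (y, [x,z]) and of ([x,y], z), all of which are already in `negRel`. -/
lemma rho_mem (x : Gen) {u : Words} (hu : u ∈ negRel h q c) :
    rho h q c x u ∈ negRel h q c := by
  -- The mode is quantified inside the induction: passing a letter y replaces x by the modes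
  -- occurring in [x,y].
  suffices H : ∀ u, NegRel h q c u → ∀ x, rho h q c x u ∈ negRel h q c from
    (Submodule.span_le (p := (negRel h q c).comap (rho h q c x))).2 (fun u hu => H u hu x) hu
  intro u hu
  induction hu with
  | rel y z hy hz u =>
    intro x
    by_cases hx : x.Neg
    · rw [rho_neg h q c hx]
      exact consL_mem x (defect_mem y z u)
    have e1 := defect_left (x := y) (fun g => defect_mem (h := h) (q := q) (c := c) y g u)
      (br_mem_sgn y x z)
    have e2 := defect_right (x := z) (fun g => defect_mem (h := h) (q := q) (c := c) g z u)
      (br_mem_sgn z x y)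
    have e3 := defect_mem (h := h) (q := q) (c := c) y z (rho h q c x u)
    have f1 := (Submodule.mem_bot ℂ).1 (defect_left (N := ⊥) (x := x) (u := u)
      (fun g => (Submodule.mem_bot ℂ).2 (defect_nonneg (h := h) (q := q) (c := c) hx g u))
      (br_mem_sgn x y z))
    have f2 := defect_nonneg (h := h) (q := q) (c := c) hx y (rho h q c z u)
    have f3 := defect_nonneg (h := h) (q := q) (c := c) hx z (rho h q c y u)
    have f4 := congrArg (rho h q c y) (defect_nonneg (h := h) (q := q) (c := c) hx z u)
    have f5 := congrArg (rho h q c z) (defect_nonneg (h := h) (q := q) (c := c) hx y u)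
    have f6 := congrArg (fun b => rhoL h q c b u) (jacobi x y z)
    convert (negRel h q c).add_mem ((negRel h q c).add_mem
      ((negRel h q c).smul_mem (sgn x y * sgn x z) e3) ((negRel h q c).smul_mem (sgn x y) e1)) e2
      using 1
    have e6 := sgn_mul_self x y
    simp only [defect, map_sub, map_add, map_smul, LinearMap.add_apply, LinearMap.smul_apply,
      map_zero, sgn_comm y x, sgn_comm z x, sgn_comm z y] at *
    linear_combination (norm := module) f2 - sgn y z • f3 - f1 + sgn x y • f4
      - (sgn y z * sgn x z) • f5 - f6
      + (sgn y z • e6) • rhoL h q c (br x z) (rho h q c y u)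
  | cons y u _ ih =>
    intro x
    by_cases hx : x.Neg
    · rw [rho_neg h q c hx]
      exact consL_mem x (by simpa [rho_neg h q c, hx] using consL_mem y (Submodule.subset_span ‹_›))
    · rw [rho_cons h q c hx]
      refine add_mem ((negRel h q c).smul_mem _ (consL_mem y (ih x))) ?_
      induction br x y using Finsupp.induction_linear with
      | zero => simp
      | add f g hf hg => simpa using add_mem hf hg
      | single g a => simpa [rhoL] using (negRel h q c).smul_mem a (ih g)

end

end

section

/-! ### Detecting vectors of the Verma module -/

open Finsupp (supported linearCombination)

section

variable (h q c : ℂ)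

/-- Action of a generator on the quotient of the space of words by the relations among the
negative modes. -/
def rhoQ (x : Gen) : Module.End ℂ (Words ⧸ negRel h q c) :=
  (negRel h q c).mapQ (negRel h q c) (rho h q c x) fun _ hu => rho_mem x hu

@[simp] lemma rhoQ_mk (x : Gen) (u : Words) : rhoQ h q c x (Submodule.Quotient.mk u) =
    Submodule.Quotient.mk (rho h q c x u) := rfl

lemma rhoQ_br (x y : Gen) : rhoQ h q c x * rhoQ h q c y - sgn x y • (rhoQ h q c y * rhoQ h q c x) =
    linearCombination ℂ (rhoQ h q c) (br x y) := by
  have H : ∀ (b : Gen →₀ ℂ) (u : Words), linearCombination ℂ (rhoQ h q c) b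
      (Submodule.Quotient.mk u) = Submodule.Quotient.mk (rhoL h q c b u) := by
    intro b u
    induction b using Finsupp.induction_linear with
    | zero => simp
    | add f g hf hg => simp [hf, hg]
    | single g a => simp [rhoL]
  refine LinearMap.ext fun u => ?_
  induction u using Submodule.Quotient.induction_on with
  | H u =>
    rw [H, ← sub_eq_zero]
    exact (Submodule.Quotient.mk_eq_zero _).2 (defect_mem (h := h) (q := q) (c := c) x y u)

/-- The representation of the enveloping algebra on the quotient of the space of words. -/
def rep : U →ₐ[ℂ] Module.End ℂ (Words ⧸ negRel h q c) :=
  RingQuot.liftAlgHom ℂ ⟨FreeAlgebra.lift ℂ (rhoQ h q c), by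
    intro a b hab
    have e := rhoQ_br h q c
    cases hab <;>
      simp only [fr, map_sub, map_add, map_mul, map_smul, map_neg, map_zero,
        FreeAlgebra.lift_ι_apply]
    case LL m n =>
      have e := e (.L m) (.L n)
      simp only [sgn, Gen.odd, br, map_add, map_smul, map_neg, map_zero,
        Finsupp.linearCombination_single, one_smul, Bool.and_true, Bool.and_false,
        Bool.false_eq_true, if_true, if_false] at e
      linear_combination (norm := module) e
    case LGp m n =>
      have e := e (.L m) (.Gp n)
      simp only [sgn, Gen.odd, br, map_add, map_smul, map_neg, map_zero,
        Finsupp.linearCombination_single, one_smul, Bool.and_true, Bool.and_false,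
        Bool.false_eq_true, if_true, if_false] at e
      linear_combination (norm := module) e
    case LGm m n =>
      have e := e (.L m) (.Gm n)
      simp only [sgn, Gen.odd, br, map_add, map_smul, map_neg, map_zero,
        Finsupp.linearCombination_single, one_smul, Bool.and_true, Bool.and_false,
        Bool.false_eq_true, if_true, if_false] at e
      linear_combination (norm := module) e
    case LT m n =>
      have e := e (.L m) (.T n)
      simp only [sgn, Gen.odd, br, map_add, map_smul, map_neg, map_zero,
        Finsupp.linearCombination_single, one_smul, Bool.and_true, Bool.and_false,
        Bool.false_eq_true, if_true, if_false] at e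
      linear_combination (norm := module) e
    case TT m n =>
      have e := e (.T m) (.T n)
      simp only [sgn, Gen.odd, br, map_add, map_smul, map_neg, map_zero,
        Finsupp.linearCombination_single, one_smul, Bool.and_true, Bool.and_false,
        Bool.false_eq_true, if_true, if_false] at e
      linear_combination (norm := module) e
    case TGp m n =>
      have e := e (.T m) (.Gp n)
      simp only [sgn, Gen.odd, br, map_add, map_smul, map_neg, map_zero,
        Finsupp.linearCombination_single, one_smul, Bool.and_true, Bool.and_false,
        Bool.false_eq_true, if_true, if_false] at e
      linear_combination (norm := module) e
    case TGm m n =>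
      have e := e (.T m) (.Gm n)
      simp only [sgn, Gen.odd, br, map_add, map_smul, map_neg, map_zero,
        Finsupp.linearCombination_single, one_smul, Bool.and_true, Bool.and_false,
        Bool.false_eq_true, if_true, if_false] at e
      linear_combination (norm := module) e
    case GpGm m n =>
      have e := e (.Gp m) (.Gm n)
      simp only [sgn, Gen.odd, br, map_add, map_smul, map_neg, map_zero,
        Finsupp.linearCombination_single, one_smul, Bool.and_true, Bool.and_false,
        Bool.false_eq_true, if_true, if_false] at e
      linear_combination (norm := module) e
    case GpGp m n =>
      have e := e (.Gp m) (.Gp n)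
      simp only [sgn, Gen.odd, br, map_add, map_smul, map_neg, map_zero,
        Finsupp.linearCombination_single, one_smul, Bool.and_true, Bool.and_false,
        Bool.false_eq_true, if_true, if_false] at e
      linear_combination (norm := module) e
    case GmGm m n =>
      have e := e (.Gm m) (.Gm n)
      simp only [sgn, Gen.odd, br, map_add, map_smul, map_neg, map_zero,
        Finsupp.linearCombination_single, one_smul, Bool.and_true, Bool.and_false,
        Bool.false_eq_true, if_true, if_false] at e
      linear_combination (norm := module) e
    case CC g => simpa [sgn, Gen.odd, br, sub_eq_zero] using e .C g⟩

@[simp] lemma rep_gen (x : Gen) : rep h q c (gen x) = rhoQ h q c x := by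
  simp [rep, gen, fr]

/-- Annihilating a fixed vector is a left ideal condition, so only the generators matter, and every
non-negative mode acts on the empty word by the character. -/
lemma rep_vermaIdeal {u : U} (hu : u ∈ vermaIdeal h q c) :
    rep h q c u (Submodule.Quotient.mk (Finsupp.single [] 1)) = 0 := by
  induction hu using Submodule.span_induction with
  | zero => simp
  | add x y _ _ hx hy => simp [hx, hy]
  | smul a x _ hx => simp [hx]
  | mem x hx =>
    have H : ∀ g : Gen, ¬ g.Neg → rep h q c (gen g)
        (Submodule.Quotient.mk (Finsupp.single [] 1)) =
        hwChar h q c g • Submodule.Quotient.mk (Finsupp.single [] 1) := by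
      intro g hg
      rw [rep_gen, rhoQ_mk, rho_nonneg_nil h q c hg, Submodule.Quotient.mk_smul]
    have A : ∀ a : ℂ, rep h q c (algebraMap ℂ U a)
        (Submodule.Quotient.mk (Finsupp.single [] 1)) =
        a • Submodule.Quotient.mk (Finsupp.single [] 1) := by
      intro a
      rw [AlgHom.commutes, Module.algebraMap_end_apply]
    rcases hx with (⟨m, hm, rfl | rfl⟩ | ⟨m, hm, rfl | rfl⟩) | rfl | rfl | rfl
    · rw [H _ (by simp only [Gen.Neg]; omega)]; simp [hwChar, hm.ne']
    · rw [H _ (by simp only [Gen.Neg]; omega)]; simp [hwChar, hm.ne']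
    · rw [H _ (by simp only [Gen.Neg]; omega)]; simp [hwChar]
    · rw [H _ (by simp only [Gen.Neg]; omega)]; simp [hwChar]
    · rw [map_sub, LinearMap.sub_apply, H _ (by simp [Gen.Neg]), A]; simp [hwChar]
    · rw [map_sub, LinearMap.sub_apply, H _ (by simp [Gen.Neg]), A]; simp [hwChar]
    · rw [map_sub, LinearMap.sub_apply, H _ (by simp [Gen.Neg]), A]; simp [hwChar]

end

/-! ### A Clifford representation that separates the two vectors -/

/-- A two-dimensional representation of the negative modes: `L_{-1}` acts by `1`, the modes
`G^±_{-1/2}` generate a Clifford algebra, and all others act by zero. -/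
def cliff : Gen → Matrix (Fin 2) (Fin 2) ℂ
  | .L m => if m = -1 then 1 else 0
  | .Gp k => if k = -1 then !![0, 1; 0, 0] else 0
  | .Gm k => if k = -1 then !![0, 0; 2, 0] else 0
  | _ => 0

/-- Among negative modes only {G⁺_{-1/2}, G⁻_{-1/2}} = 2L_{-1} can produce L_{-1}, and no bracket
produces G^±_{-1/2}. The factor 2 in the matrix of G⁻_{-1/2} matches that relation, and L_{-1},
acting as a scalar, commutes with everything. -/
lemma cliff_br {x y : Gen} (hx : x.Neg) (hy : y.Neg) :
    cliff x * cliff y - sgn x y • (cliff y * cliff x) = linearCombination ℂ cliff (br x y) := by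
  cases x <;> cases y <;> simp only [Gen.Neg] at hx hy <;>
    simp only [br, map_add, map_smul, map_neg, map_zero, Finsupp.linearCombination_single,
      cliff, sgn, Gen.odd, one_smul, smul_zero, add_zero, zero_mul, mul_zero, sub_zero,
      Bool.and_true, Bool.and_false, Bool.false_eq_true, if_true, if_false]
  case L.L m n =>
    rw [if_neg (show ¬ m + n = -1 by omega)]
    split_ifs <;> simp
  case L.Gp m n =>
    rw [if_neg (show ¬ m + n = -1 by omega)]
    split_ifs <;> simp
  case L.Gm m n =>
    rw [if_neg (show ¬ m + n = -1 by omega)]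
    split_ifs <;> simp
  case Gp.L n m =>
    rw [if_neg (show ¬ m + n = -1 by omega)]
    split_ifs <;> simp
  case Gm.L n m =>
    rw [if_neg (show ¬ m + n = -1 by omega)]
    split_ifs <;> simp
  case T.Gp m n => simp [show ¬ m + n = -1 by omega]
  case T.Gm m n => simp [show ¬ m + n = -1 by omega]
  case Gp.T n m => simp [show ¬ m + n = -1 by omega]
  case Gm.T n m => simp [show ¬ m + n = -1 by omega]
  case Gp.Gp n m => split_ifs <;> simp
  case Gm.Gm n m => split_ifs <;> simp
  case Gp.Gm n m =>
    by_cases h : n = -1 ∧ m = -1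
    · obtain ⟨rfl, rfl⟩ := h
      ext i j; fin_cases i <;> fin_cases j <;> simp
    · rw [if_neg (show ¬ n + m + 1 = -1 by omega)]
      split_ifs <;> first | omega | simp
  case Gm.Gp m n =>
    by_cases h : n = -1 ∧ m = -1
    · obtain ⟨rfl, rfl⟩ := h
      ext i j; fin_cases i <;> fin_cases j <;> simp
    · rw [if_neg (show ¬ n + m + 1 = -1 by omega)]
      split_ifs <;> first | omega | simp

/-- Evaluation of words in the two-dimensional representation of the negative modes. -/
def cliffEval : Words →ₗ[ℂ] Matrix (Fin 2) (Fin 2) ℂ :=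
  linearCombination ℂ fun w => (w.map cliff).prod

lemma cliffEval_consL (y : Gen) (u : Words) : cliffEval (consL y u) = cliff y * cliffEval u := by
  induction u using Finsupp.induction_linear with
  | zero => simp
  | add f g hf hg => simp only [map_add, hf, hg, mul_add]
  | single w a => simp [cliffEval]

lemma cliffEval_negRel {h q c : ℂ} : negRel h q c ≤ LinearMap.ker cliffEval := by
  refine Submodule.span_le.2 fun u hu => ?_
  change cliffEval u = 0
  induction hu with
  | cons y u _ ih => rw [cliffEval_consL, ih, mul_zero]
  | rel x y hx hy u =>
    have H : cliffEval (rhoL h q c (br x y) u) =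
        linearCombination ℂ cliff (br x y) * cliffEval u := by
      refine supported_induction (p := fun b => cliffEval (rhoL h q c b u) =
        linearCombination ℂ cliff b * cliffEval u) (br_mem_neg hx hy) ?_ ?_ ?_ ?_
      · intro g hg
        simp [rho_neg h q c hg, cliffEval_consL]
      · simp
      · intro b b' hb hb'
        simp [hb, hb', add_mul]
      · intro a b hb
        simp [hb]
    rw [defect, map_sub, map_sub, map_smul, H, ← cliff_br hx hy, rho_neg h q c hx,
      rho_neg h q c hy]
    simp [cliffEval_consL, sub_mul, mul_assoc]

/-- Evaluation of the enveloping algebra, applied to the highest weight vector, in the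
two-dimensional representation of the negative modes. -/
def detect (h q c : ℂ) : U →ₗ[ℂ] Matrix (Fin 2) (Fin 2) ℂ :=
  (negRel h q c).liftQ cliffEval cliffEval_negRel ∘ₗ
    LinearMap.applyₗ (Submodule.Quotient.mk (Finsupp.single [] 1)) ∘ₗ (rep h q c).toLinearMap

variable {h q c : ℂ}

/-- This turns a matrix computation into a nonvanishing criterion in the Verma module; PBW is not
needed. -/
lemma detect_eq_zero {u : U} (hu : u • hw h q c = 0) : detect h q c u = 0 := by
  rw [hw, ← Submodule.Quotient.mk_smul, Submodule.Quotient.mk_eq_zero, smul_eq_mul, mul_one] at hu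
  simp [detect, rep_vermaIdeal h q c hu]

lemma detect_one : detect h q c 1 = 1 := by
  simp only [detect, LinearMap.comp_apply, AlgHom.toLinearMap_apply, map_one,
    LinearMap.applyₗ_apply_apply, Module.End.one_apply]
  rw [Submodule.liftQ_apply]
  simp [cliffEval]

lemma detect_gen_mul {x : Gen} (hx : x.Neg) (u : U) :
    detect h q c (gen x * u) = cliff x * detect h q c u := by
  simp only [detect, LinearMap.comp_apply, AlgHom.toLinearMap_apply, map_mul,
    LinearMap.applyₗ_apply_apply, Module.End.mul_apply, rep_gen]
  generalize rep h q c u (Submodule.Quotient.mk (Finsupp.single [] 1)) = v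
  induction v using Submodule.Quotient.induction_on with
  | H v =>
    rw [rhoQ_mk, rho_neg h q c hx, ← Submodule.mkQ_apply, ← Submodule.mkQ_apply]
    exact cliffEval_consL x v

lemma detect_gen {x : Gen} (hx : x.Neg) : detect h q c (gen x) = cliff x := by
  rw [← mul_one (gen x), detect_gen_mul hx, detect_one, mul_one]

/-- Only 4L_{-1}³ and -2L_{-1}²G⁺_{-1/2}G⁻_{-1/2} survive, and G⁺_{-1/2}G⁻_{-1/2} acts as diag(2,0);
hence the answer does not depend on t or on the weight. -/
lemma detect_delta01 (t : ℂ) : detect h q c (delta01 t) = !![0, 0; 0, 4] := by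
  simp (disch := simp only [Gen.Neg]; norm_num) only [delta01, L₁, L₂, L₃, T₁, T₂, T₃, P₁, P₃, P₅, M₁, M₃, M₅, pow_succ, pow_zero, one_mul,
    mul_assoc, map_add, map_sub, map_smul, detect_gen_mul, detect_gen, cliff]
  ext i j; fin_cases i <;> fin_cases j <;> norm_num

lemma detect_delta10 (t : ℂ) : detect h q c (delta10 t) = !![4, 0; 0, 0] := by
  simp (disch := simp only [Gen.Neg]; norm_num) only [delta10, L₁, L₂, L₃, T₁, T₂, T₃, P₁, P₃, P₅, M₁, M₃, M₅, pow_succ, pow_zero, one_mul,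
    mul_assoc, map_add, map_sub, map_smul, detect_gen_mul, detect_gen, cliff]
  ext i j; fin_cases i <;> fin_cases j <;> norm_num

end

/-! ### Commutation relations in a module over the enveloping algebra -/

lemma mkAlgHom_eq {a b : FreeAlgebra ℂ Gen} (h : Rel a b) :
    RingQuot.mkAlgHom ℂ Rel a = RingQuot.mkAlgHom ℂ Rel b :=
  RingQuot.mkAlgHom_rel ℂ h

lemma rel_LL (m n : ℤ) : gen (.L m) * gen (.L n) - gen (.L n) * gen (.L m) =
    ((m : ℂ) - n) • gen (.L (m + n)) + (if m + n = 0 then ((m : ℂ) ^ 3 - m) / 12 else 0) • gen .C := by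
  simpa only [gen, map_sub, map_add, map_mul, map_smul, map_neg, map_zero] using
    mkAlgHom_eq (.LL m n)

lemma rel_LGp (m k : ℤ) : gen (.L m) * gen (.Gp k) - gen (.Gp k) * gen (.L m) =
    ((m : ℂ) / 2 - (k + 1 / 2)) • gen (.Gp (m + k)) := by
  simpa only [gen, map_sub, map_add, map_mul, map_smul, map_neg, map_zero] using
    mkAlgHom_eq (.LGp m k)

lemma rel_LGm (m k : ℤ) : gen (.L m) * gen (.Gm k) - gen (.Gm k) * gen (.L m) =
    ((m : ℂ) / 2 - (k + 1 / 2)) • gen (.Gm (m + k)) := by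
  simpa only [gen, map_sub, map_add, map_mul, map_smul, map_neg, map_zero] using
    mkAlgHom_eq (.LGm m k)

lemma rel_LT (m n : ℤ) : gen (.L m) * gen (.T n) - gen (.T n) * gen (.L m) =
    -(n : ℂ) • gen (.T (m + n)) := by
  simpa only [gen, map_sub, map_add, map_mul, map_smul, map_neg, map_zero] using
    mkAlgHom_eq (.LT m n)

lemma rel_TT (m n : ℤ) : gen (.T m) * gen (.T n) - gen (.T n) * gen (.T m) =
    (if m + n = 0 then (m : ℂ) / 3 else 0) • gen .C := by
  simpa only [gen, map_sub, map_add, map_mul, map_smul, map_neg, map_zero] using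
    mkAlgHom_eq (.TT m n)

lemma rel_TGp (m k : ℤ) : gen (.T m) * gen (.Gp k) - gen (.Gp k) * gen (.T m) =
    gen (.Gp (m + k)) := by
  simpa only [gen, map_sub, map_add, map_mul, map_smul, map_neg, map_zero] using
    mkAlgHom_eq (.TGp m k)

lemma rel_TGm (m k : ℤ) : gen (.T m) * gen (.Gm k) - gen (.Gm k) * gen (.T m) =
    -gen (.Gm (m + k)) := by
  simpa only [gen, map_sub, map_add, map_mul, map_smul, map_neg, map_zero] using
    mkAlgHom_eq (.TGm m k)

lemma rel_GpGm (k l : ℤ) : gen (.Gp k) * gen (.Gm l) + gen (.Gm l) * gen (.Gp k) =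
    (2 : ℂ) • gen (.L (k + l + 1)) + ((k : ℂ) - l) • gen (.T (k + l + 1)) +
        (if k + l + 1 = 0 then (((k : ℂ) + 1 / 2) ^ 2 - 1 / 4) / 3 else 0) • gen .C := by
  simpa only [gen, map_sub, map_add, map_mul, map_smul, map_neg, map_zero] using
    mkAlgHom_eq (.GpGm k l)

lemma rel_GpGp (k l : ℤ) : gen (.Gp k) * gen (.Gp l) + gen (.Gp l) * gen (.Gp k) =
    0 := by
  simpa only [gen, map_sub, map_add, map_mul, map_smul, map_neg, map_zero] using
    mkAlgHom_eq (.GpGp k l)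

lemma rel_GmGm (k l : ℤ) : gen (.Gm k) * gen (.Gm l) + gen (.Gm l) * gen (.Gm k) =
    0 := by
  simpa only [gen, map_sub, map_add, map_mul, map_smul, map_neg, map_zero] using
    mkAlgHom_eq (.GmGm k l)

lemma rel_CC (g : Gen) : gen .C * gen g = gen g * gen .C := by
  simpa only [gen, map_mul] using mkAlgHom_eq (.CC g)

section

variable {V : Type*} [AddCommGroup V] [Module U V]

lemma smul_eq_of_sub {x y r : U} (e : x * y - y * x = r) (v : V) :
    x • y • v = y • x • v + r • v := by
  rw [← e, sub_smul, mul_smul, mul_smul]; abel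

lemma smul_eq_of_sub' {x y r : U} (e : x * y - y * x = r) (v : V) :
    y • x • v = x • y • v - r • v := by
  rw [← e, sub_smul, mul_smul, mul_smul]; abel

lemma smul_eq_of_add {x y r : U} (e : x * y + y * x = r) (v : V) :
    x • y • v = -(y • x • v) + r • v := by
  rw [← e, add_smul, mul_smul, mul_smul]; abel

lemma smul_eq_of_add' {x y r : U} (e : x * y + y * x = r) (v : V) :
    y • x • v = -(x • y • v) + r • v := by
  rw [← e, add_smul, mul_smul, mul_smul]; abel

variable [Module ℂ V] [IsScalarTower ℂ U V]

/-- The action of an element of the enveloping algebra as a linear map. -/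
def op (u : U) : V →ₗ[ℂ] V := Algebra.lsmul ℂ ℂ V u

lemma op_apply (u : U) (v : V) : op u v = u • v := rfl

lemma LL_smul (m n : ℤ) (v : V) : gen (.L m) • gen (.L n) • v =
    gen (.L n) • gen (.L m) • v + (((m : ℂ) - n) • gen (.L (m + n)) • v + (if m + n = 0 then ((m : ℂ) ^ 3 - m) / 12 else 0) • gen .C • v) := by
  rw [smul_eq_of_sub (rel_LL m n)]
  simp only [add_smul, neg_smul, smul_assoc, zero_smul]

lemma LGp_smul (m k : ℤ) (v : V) : gen (.L m) • gen (.Gp k) • v =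
    gen (.Gp k) • gen (.L m) • v + (((m : ℂ) / 2 - (k + 1 / 2)) • gen (.Gp (m + k)) • v) := by
  rw [smul_eq_of_sub (rel_LGp m k)]
  simp only [add_smul, neg_smul, smul_assoc, zero_smul]

lemma GpL_smul (k m : ℤ) (v : V) : gen (.Gp k) • gen (.L m) • v =
    gen (.L m) • gen (.Gp k) • v - (((m : ℂ) / 2 - (k + 1 / 2)) • gen (.Gp (m + k)) • v) := by
  rw [smul_eq_of_sub' (rel_LGp m k)]
  simp only [add_smul, neg_smul, smul_assoc, zero_smul]

lemma LGm_smul (m k : ℤ) (v : V) : gen (.L m) • gen (.Gm k) • v =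
    gen (.Gm k) • gen (.L m) • v + (((m : ℂ) / 2 - (k + 1 / 2)) • gen (.Gm (m + k)) • v) := by
  rw [smul_eq_of_sub (rel_LGm m k)]
  simp only [add_smul, neg_smul, smul_assoc, zero_smul]

lemma GmL_smul (k m : ℤ) (v : V) : gen (.Gm k) • gen (.L m) • v =
    gen (.L m) • gen (.Gm k) • v - (((m : ℂ) / 2 - (k + 1 / 2)) • gen (.Gm (m + k)) • v) := by
  rw [smul_eq_of_sub' (rel_LGm m k)]
  simp only [add_smul, neg_smul, smul_assoc, zero_smul]

lemma LT_smul (m n : ℤ) (v : V) : gen (.L m) • gen (.T n) • v =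
    gen (.T n) • gen (.L m) • v + (-(n : ℂ) • gen (.T (m + n)) • v) := by
  rw [smul_eq_of_sub (rel_LT m n)]
  simp only [add_smul, neg_smul, smul_assoc, zero_smul]

lemma TL_smul (n m : ℤ) (v : V) : gen (.T n) • gen (.L m) • v =
    gen (.L m) • gen (.T n) • v - (-(n : ℂ) • gen (.T (m + n)) • v) := by
  rw [smul_eq_of_sub' (rel_LT m n)]
  simp only [add_smul, neg_smul, smul_assoc, zero_smul]

lemma TT_smul (m n : ℤ) (v : V) : gen (.T m) • gen (.T n) • v =
    gen (.T n) • gen (.T m) • v + ((if m + n = 0 then (m : ℂ) / 3 else 0) • gen .C • v) := by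
  rw [smul_eq_of_sub (rel_TT m n)]
  simp only [add_smul, neg_smul, smul_assoc, zero_smul]

lemma TGp_smul (m k : ℤ) (v : V) : gen (.T m) • gen (.Gp k) • v =
    gen (.Gp k) • gen (.T m) • v + (gen (.Gp (m + k)) • v) := by
  rw [smul_eq_of_sub (rel_TGp m k)]

lemma GpT_smul (k m : ℤ) (v : V) : gen (.Gp k) • gen (.T m) • v =
    gen (.T m) • gen (.Gp k) • v - (gen (.Gp (m + k)) • v) := by
  rw [smul_eq_of_sub' (rel_TGp m k)]

lemma TGm_smul (m k : ℤ) (v : V) : gen (.T m) • gen (.Gm k) • v =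
    gen (.Gm k) • gen (.T m) • v + (-(gen (.Gm (m + k)) • v)) := by
  rw [smul_eq_of_sub (rel_TGm m k)]
  simp only [add_smul, neg_smul, smul_assoc, zero_smul]

lemma GmT_smul (k m : ℤ) (v : V) : gen (.Gm k) • gen (.T m) • v =
    gen (.T m) • gen (.Gm k) • v - (-(gen (.Gm (m + k)) • v)) := by
  rw [smul_eq_of_sub' (rel_TGm m k)]
  simp only [add_smul, neg_smul, smul_assoc, zero_smul]

lemma GpGm_smul (k l : ℤ) (v : V) : gen (.Gp k) • gen (.Gm l) • v =
    -(gen (.Gm l) • gen (.Gp k) • v) + ((2 : ℂ) • gen (.L (k + l + 1)) • v + ((k : ℂ) - l) • gen (.T (k + l + 1)) • v +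
        (if k + l + 1 = 0 then (((k : ℂ) + 1 / 2) ^ 2 - 1 / 4) / 3 else 0) • gen .C • v) := by
  rw [smul_eq_of_add (rel_GpGm k l)]
  simp only [add_smul, neg_smul, smul_assoc, zero_smul]

lemma GmGp_smul (l k : ℤ) (v : V) : gen (.Gm l) • gen (.Gp k) • v =
    -(gen (.Gp k) • gen (.Gm l) • v) + ((2 : ℂ) • gen (.L (k + l + 1)) • v + ((k : ℂ) - l) • gen (.T (k + l + 1)) • v +
        (if k + l + 1 = 0 then (((k : ℂ) + 1 / 2) ^ 2 - 1 / 4) / 3 else 0) • gen .C • v) := by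
  rw [smul_eq_of_add' (rel_GpGm k l)]
  simp only [add_smul, neg_smul, smul_assoc, zero_smul]

lemma GpGp_smul (k l : ℤ) (v : V) : gen (.Gp k) • gen (.Gp l) • v =
    -(gen (.Gp l) • gen (.Gp k) • v) + (0) := by
  rw [smul_eq_of_add (rel_GpGp k l)]
  simp only [add_smul, neg_smul, smul_assoc, zero_smul]

lemma GmGm_smul (k l : ℤ) (v : V) : gen (.Gm k) • gen (.Gm l) • v =
    -(gen (.Gm l) • gen (.Gm k) • v) + (0) := by
  rw [smul_eq_of_add (rel_GmGm k l)]
  simp only [add_smul, neg_smul, smul_assoc, zero_smul]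

lemma C_smul (g : Gen) (v : V) : gen .C • gen g • v = gen g • gen .C • v := by
  rw [← mul_smul, rel_CC, mul_smul]

lemma GpGp_smul_self (k : ℤ) (v : V) : gen (.Gp k) • gen (.Gp k) • v = 0 := by
  have e : (2 : ℂ) • gen (.Gp k) • gen (.Gp k) • v = 0 := by
    rw [two_smul]
    exact add_eq_zero_iff_eq_neg.2 ((GpGp_smul k k v).trans (add_zero _))
  exact (smul_eq_zero.1 e).resolve_left two_ne_zero

lemma GmGm_smul_self (k : ℤ) (v : V) : gen (.Gm k) • gen (.Gm k) • v = 0 := by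
  have e : (2 : ℂ) • gen (.Gm k) • gen (.Gm k) • v = 0 := by
    rw [two_smul]
    exact add_eq_zero_iff_eq_neg.2 ((GmGm_smul k k v).trans (add_zero _))
  exact (smul_eq_zero.1 e).resolve_left two_ne_zero

variable (V)

/-- Commutation of a mode with the negative modes. -/
lemma Gp_zero_smul_neg :
    (∀ v : V, op (gen (.Gp 0)) (op L₁ v) = op L₁ (op (gen (.Gp 0)) v) + op P₁ v) ∧
    (∀ v : V, op (gen (.Gp 0)) (op L₂ v) = op L₂ (op (gen (.Gp 0)) v) + (3 / 2 : ℂ) • op P₃ v) ∧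
    (∀ v : V, op (gen (.Gp 0)) (op L₃ v) = op L₃ (op (gen (.Gp 0)) v) + (2 : ℂ) • op P₅ v) ∧
    (∀ v : V, op (gen (.Gp 0)) (op T₁ v) = op T₁ (op (gen (.Gp 0)) v) - op P₁ v) ∧
    (∀ v : V, op (gen (.Gp 0)) (op T₂ v) = op T₂ (op (gen (.Gp 0)) v) - op P₃ v) ∧
    (∀ v : V, op (gen (.Gp 0)) (op T₃ v) = op T₃ (op (gen (.Gp 0)) v) - op P₅ v) ∧
    (∀ v : V, op (gen (.Gp 0)) (op P₁ v) = -op P₁ (op (gen (.Gp 0)) v)) ∧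
    (∀ v : V, op (gen (.Gp 0)) (op P₃ v) = -op P₃ (op (gen (.Gp 0)) v)) ∧
    (∀ v : V, op (gen (.Gp 0)) (op P₅ v) = -op P₅ (op (gen (.Gp 0)) v)) ∧
    (∀ v : V, op (gen (.Gp 0)) (op M₁ v) = -op M₁ (op (gen (.Gp 0)) v) + (2 : ℂ) • op (gen (.L 0)) v + op (gen (.T 0)) v) ∧
    (∀ v : V, op (gen (.Gp 0)) (op M₃ v) = -op M₃ (op (gen (.Gp 0)) v) + (2 : ℂ) • op L₁ v + (2 : ℂ) • op T₁ v) ∧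
    (∀ v : V, op (gen (.Gp 0)) (op M₅ v) = -op M₅ (op (gen (.Gp 0)) v) + (2 : ℂ) • op L₂ v + (3 : ℂ) • op T₂ v) := by
  and_intros <;> intro v <;>
    simp only [op_apply, L₁, L₂, L₃, T₁, T₂, T₃, P₁, P₃, P₅, M₁, M₃, M₅] <;>
    first
    | rw [GpL_smul] | rw [GpT_smul] | rw [GpGp_smul] | rw [GpGm_smul]
  all_goals norm_num [add_assoc, sub_eq_add_neg]

/-- Commutation of a mode with the negative modes. -/
lemma Gm_zero_smul_neg :
    (∀ v : V, op (gen (.Gm 0)) (op L₁ v) = op L₁ (op (gen (.Gm 0)) v) + op M₁ v) ∧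
    (∀ v : V, op (gen (.Gm 0)) (op L₂ v) = op L₂ (op (gen (.Gm 0)) v) + (3 / 2 : ℂ) • op M₃ v) ∧
    (∀ v : V, op (gen (.Gm 0)) (op L₃ v) = op L₃ (op (gen (.Gm 0)) v) + (2 : ℂ) • op M₅ v) ∧
    (∀ v : V, op (gen (.Gm 0)) (op T₁ v) = op T₁ (op (gen (.Gm 0)) v) + op M₁ v) ∧
    (∀ v : V, op (gen (.Gm 0)) (op T₂ v) = op T₂ (op (gen (.Gm 0)) v) + op M₃ v) ∧
    (∀ v : V, op (gen (.Gm 0)) (op T₃ v) = op T₃ (op (gen (.Gm 0)) v) + op M₅ v) ∧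
    (∀ v : V, op (gen (.Gm 0)) (op P₁ v) = -op P₁ (op (gen (.Gm 0)) v) + (2 : ℂ) • op (gen (.L 0)) v - op (gen (.T 0)) v) ∧
    (∀ v : V, op (gen (.Gm 0)) (op P₃ v) = -op P₃ (op (gen (.Gm 0)) v) + (2 : ℂ) • op L₁ v + (-2 : ℂ) • op T₁ v) ∧
    (∀ v : V, op (gen (.Gm 0)) (op P₅ v) = -op P₅ (op (gen (.Gm 0)) v) + (2 : ℂ) • op L₂ v + (-3 : ℂ) • op T₂ v) ∧
    (∀ v : V, op (gen (.Gm 0)) (op M₁ v) = -op M₁ (op (gen (.Gm 0)) v)) ∧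
    (∀ v : V, op (gen (.Gm 0)) (op M₃ v) = -op M₃ (op (gen (.Gm 0)) v)) ∧
    (∀ v : V, op (gen (.Gm 0)) (op M₅ v) = -op M₅ (op (gen (.Gm 0)) v)) := by
  and_intros <;> intro v <;>
    simp only [op_apply, L₁, L₂, L₃, T₁, T₂, T₃, P₁, P₃, P₅, M₁, M₃, M₅] <;>
    first
    | rw [GmL_smul] | rw [GmT_smul] | rw [GmGp_smul] | rw [GmGm_smul]
  all_goals norm_num [add_assoc, sub_eq_add_neg]

/-- Commutation of a mode with the negative modes. -/
lemma T_one_smul_neg :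
    (∀ v : V, op (gen (.T 1)) (op L₁ v) = op L₁ (op (gen (.T 1)) v) + op (gen (.T 0)) v) ∧
    (∀ v : V, op (gen (.T 1)) (op L₂ v) = op L₂ (op (gen (.T 1)) v) + op T₁ v) ∧
    (∀ v : V, op (gen (.T 1)) (op L₃ v) = op L₃ (op (gen (.T 1)) v) + op T₂ v) ∧
    (∀ v : V, op (gen (.T 1)) (op T₁ v) = op T₁ (op (gen (.T 1)) v) + (1 / 3 : ℂ) • op (gen .C) v) ∧
    (∀ v : V, op (gen (.T 1)) (op T₂ v) = op T₂ (op (gen (.T 1)) v)) ∧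
    (∀ v : V, op (gen (.T 1)) (op T₃ v) = op T₃ (op (gen (.T 1)) v)) ∧
    (∀ v : V, op (gen (.T 1)) (op P₁ v) = op P₁ (op (gen (.T 1)) v) + op (gen (.Gp 0)) v) ∧
    (∀ v : V, op (gen (.T 1)) (op P₃ v) = op P₃ (op (gen (.T 1)) v) + op P₁ v) ∧
    (∀ v : V, op (gen (.T 1)) (op P₅ v) = op P₅ (op (gen (.T 1)) v) + op P₃ v) ∧
    (∀ v : V, op (gen (.T 1)) (op M₁ v) = op M₁ (op (gen (.T 1)) v) - op (gen (.Gm 0)) v) ∧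
    (∀ v : V, op (gen (.T 1)) (op M₃ v) = op M₃ (op (gen (.T 1)) v) - op M₁ v) ∧
    (∀ v : V, op (gen (.T 1)) (op M₅ v) = op M₅ (op (gen (.T 1)) v) - op M₃ v) := by
  and_intros <;> intro v <;>
    simp only [op_apply, L₁, L₂, L₃, T₁, T₂, T₃, P₁, P₃, P₅, M₁, M₃, M₅] <;>
    first
    | rw [TL_smul] | rw [TT_smul] | rw [TGp_smul] | rw [TGm_smul]
  all_goals norm_num [add_assoc, sub_eq_add_neg]

/-- Commutation of a mode with the negative modes. -/
lemma L_zero_smul_neg :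
    (∀ v : V, op (gen (.L 0)) (op L₁ v) = op L₁ (op (gen (.L 0)) v) + op L₁ v) ∧
    (∀ v : V, op (gen (.L 0)) (op L₂ v) = op L₂ (op (gen (.L 0)) v) + (2 : ℂ) • op L₂ v) ∧
    (∀ v : V, op (gen (.L 0)) (op L₃ v) = op L₃ (op (gen (.L 0)) v) + (3 : ℂ) • op L₃ v) ∧
    (∀ v : V, op (gen (.L 0)) (op T₁ v) = op T₁ (op (gen (.L 0)) v) + op T₁ v) ∧
    (∀ v : V, op (gen (.L 0)) (op T₂ v) = op T₂ (op (gen (.L 0)) v) + (2 : ℂ) • op T₂ v) ∧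
    (∀ v : V, op (gen (.L 0)) (op T₃ v) = op T₃ (op (gen (.L 0)) v) + (3 : ℂ) • op T₃ v) ∧
    (∀ v : V, op (gen (.L 0)) (op P₁ v) = op P₁ (op (gen (.L 0)) v) + (1 / 2 : ℂ) • op P₁ v) ∧
    (∀ v : V, op (gen (.L 0)) (op P₃ v) = op P₃ (op (gen (.L 0)) v) + (3 / 2 : ℂ) • op P₃ v) ∧
    (∀ v : V, op (gen (.L 0)) (op P₅ v) = op P₅ (op (gen (.L 0)) v) + (5 / 2 : ℂ) • op P₅ v) ∧
    (∀ v : V, op (gen (.L 0)) (op M₁ v) = op M₁ (op (gen (.L 0)) v) + (1 / 2 : ℂ) • op M₁ v) ∧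
    (∀ v : V, op (gen (.L 0)) (op M₃ v) = op M₃ (op (gen (.L 0)) v) + (3 / 2 : ℂ) • op M₃ v) ∧
    (∀ v : V, op (gen (.L 0)) (op M₅ v) = op M₅ (op (gen (.L 0)) v) + (5 / 2 : ℂ) • op M₅ v) := by
  and_intros <;> intro v <;>
    simp only [op_apply, L₁, L₂, L₃, T₁, T₂, T₃, P₁, P₃, P₅, M₁, M₃, M₅] <;>
    first
    | rw [LL_smul] | rw [LT_smul] | rw [LGp_smul] | rw [LGm_smul]
  all_goals norm_num [add_assoc, sub_eq_add_neg]

/-- Commutation of a mode with the negative modes. -/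
lemma T_zero_smul_neg :
    (∀ v : V, op (gen (.T 0)) (op L₁ v) = op L₁ (op (gen (.T 0)) v)) ∧
    (∀ v : V, op (gen (.T 0)) (op L₂ v) = op L₂ (op (gen (.T 0)) v)) ∧
    (∀ v : V, op (gen (.T 0)) (op L₃ v) = op L₃ (op (gen (.T 0)) v)) ∧
    (∀ v : V, op (gen (.T 0)) (op T₁ v) = op T₁ (op (gen (.T 0)) v)) ∧
    (∀ v : V, op (gen (.T 0)) (op T₂ v) = op T₂ (op (gen (.T 0)) v)) ∧
    (∀ v : V, op (gen (.T 0)) (op T₃ v) = op T₃ (op (gen (.T 0)) v)) ∧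
    (∀ v : V, op (gen (.T 0)) (op P₁ v) = op P₁ (op (gen (.T 0)) v) + op P₁ v) ∧
    (∀ v : V, op (gen (.T 0)) (op P₃ v) = op P₃ (op (gen (.T 0)) v) + op P₃ v) ∧
    (∀ v : V, op (gen (.T 0)) (op P₅ v) = op P₅ (op (gen (.T 0)) v) + op P₅ v) ∧
    (∀ v : V, op (gen (.T 0)) (op M₁ v) = op M₁ (op (gen (.T 0)) v) - op M₁ v) ∧
    (∀ v : V, op (gen (.T 0)) (op M₃ v) = op M₃ (op (gen (.T 0)) v) - op M₃ v) ∧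
    (∀ v : V, op (gen (.T 0)) (op M₅ v) = op M₅ (op (gen (.T 0)) v) - op M₅ v) := by
  and_intros <;> intro v <;>
    simp only [op_apply, L₁, L₂, L₃, T₁, T₂, T₃, P₁, P₃, P₅, M₁, M₃, M₅] <;>
    first
    | rw [TL_smul] | rw [TT_smul] | rw [TGp_smul] | rw [TGm_smul]
  all_goals norm_num [add_assoc, sub_eq_add_neg]

/-- Commutation of a mode with the negative modes. -/
lemma C_smul_neg :
    (∀ v : V, op (gen .C) (op L₁ v) = op L₁ (op (gen .C) v)) ∧
    (∀ v : V, op (gen .C) (op L₂ v) = op L₂ (op (gen .C) v)) ∧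
    (∀ v : V, op (gen .C) (op L₃ v) = op L₃ (op (gen .C) v)) ∧
    (∀ v : V, op (gen .C) (op T₁ v) = op T₁ (op (gen .C) v)) ∧
    (∀ v : V, op (gen .C) (op T₂ v) = op T₂ (op (gen .C) v)) ∧
    (∀ v : V, op (gen .C) (op T₃ v) = op T₃ (op (gen .C) v)) ∧
    (∀ v : V, op (gen .C) (op P₁ v) = op P₁ (op (gen .C) v)) ∧
    (∀ v : V, op (gen .C) (op P₃ v) = op P₃ (op (gen .C) v)) ∧
    (∀ v : V, op (gen .C) (op P₅ v) = op P₅ (op (gen .C) v)) ∧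
    (∀ v : V, op (gen .C) (op M₁ v) = op M₁ (op (gen .C) v)) ∧
    (∀ v : V, op (gen .C) (op M₃ v) = op M₃ (op (gen .C) v)) ∧
    (∀ v : V, op (gen .C) (op M₅ v) = op M₅ (op (gen .C) v)) := by
  and_intros <;> intro v <;>
    simp only [op_apply, L₁, L₂, L₃, T₁, T₂, T₃, P₁, P₃, P₅, M₁, M₃, M₅] <;>
    rw [C_smul]

/-- Reordering of negative modes. -/
lemma neg_smul_neg :
    (∀ v : V, op L₁ (op L₂ v) = op L₂ (op L₁ v) + op L₃ v) ∧
    (∀ v : V, op T₁ (op L₁ v) = op L₁ (op T₁ v) - op T₂ v) ∧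
    (∀ v : V, op T₁ (op L₂ v) = op L₂ (op T₁ v) - op T₃ v) ∧
    (∀ v : V, op T₁ (op T₂ v) = op T₂ (op T₁ v)) ∧
    (∀ v : V, op T₂ (op L₁ v) = op L₁ (op T₂ v) + (-2 : ℂ) • op T₃ v) ∧
    (∀ v : V, op P₁ (op L₁ v) = op L₁ (op P₁ v)) ∧
    (∀ v : V, op P₁ (op L₂ v) = op L₂ (op P₁ v) + (1 / 2 : ℂ) • op P₅ v) ∧
    (∀ v : V, op P₁ (op T₁ v) = op T₁ (op P₁ v) - op P₃ v) ∧
    (∀ v : V, op P₁ (op T₂ v) = op T₂ (op P₁ v) - op P₅ v) ∧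
    (∀ v : V, op P₁ (op P₁ v) = 0) ∧
    (∀ v : V, op P₃ (op L₁ v) = op L₁ (op P₃ v) - op P₅ v) ∧
    (∀ v : V, op P₃ (op T₁ v) = op T₁ (op P₃ v) - op P₅ v) ∧
    (∀ v : V, op P₃ (op P₁ v) = -op P₁ (op P₃ v)) ∧
    (∀ v : V, op P₃ (op P₃ v) = 0) ∧
    (∀ v : V, op P₅ (op P₁ v) = -op P₁ (op P₅ v)) ∧
    (∀ v : V, op M₁ (op L₁ v) = op L₁ (op M₁ v)) ∧
    (∀ v : V, op M₁ (op L₂ v) = op L₂ (op M₁ v) + (1 / 2 : ℂ) • op M₅ v) ∧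
    (∀ v : V, op M₁ (op T₁ v) = op T₁ (op M₁ v) + op M₃ v) ∧
    (∀ v : V, op M₁ (op T₂ v) = op T₂ (op M₁ v) + op M₅ v) ∧
    (∀ v : V, op M₁ (op P₁ v) = -op P₁ (op M₁ v) + (2 : ℂ) • op L₁ v) ∧
    (∀ v : V, op M₁ (op P₃ v) = -op P₃ (op M₁ v) + (2 : ℂ) • op L₂ v - op T₂ v) ∧
    (∀ v : V, op M₁ (op P₅ v) = -op P₅ (op M₁ v) + (2 : ℂ) • op L₃ v + (-2 : ℂ) • op T₃ v) ∧
    (∀ v : V, op M₁ (op M₁ v) = 0) ∧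
    (∀ v : V, op M₃ (op L₁ v) = op L₁ (op M₃ v) - op M₅ v) ∧
    (∀ v : V, op M₃ (op T₁ v) = op T₁ (op M₃ v) + op M₅ v) ∧
    (∀ v : V, op M₃ (op P₁ v) = -op P₁ (op M₃ v) + (2 : ℂ) • op L₂ v + op T₂ v) ∧
    (∀ v : V, op M₃ (op P₃ v) = -op P₃ (op M₃ v) + (2 : ℂ) • op L₃ v) ∧
    (∀ v : V, op M₃ (op M₁ v) = -op M₁ (op M₃ v)) ∧
    (∀ v : V, op M₃ (op M₃ v) = 0) ∧
    (∀ v : V, op M₅ (op P₁ v) = -op P₁ (op M₅ v) + (2 : ℂ) • op L₃ v + (2 : ℂ) • op T₃ v) ∧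
    (∀ v : V, op M₅ (op M₁ v) = -op M₁ (op M₅ v)) := by
  and_intros <;> intro v <;>
    simp only [op_apply, L₁, L₂, L₃, T₁, T₂, T₃, P₁, P₃, P₅, M₁, M₃, M₅] <;>
    first
    | rw [GpGp_smul_self] | rw [GmGm_smul_self] | rw [LL_smul] | rw [TL_smul] | rw [TT_smul]
    | rw [GpL_smul] | rw [GpT_smul] | rw [GpGp_smul] | rw [GmL_smul] | rw [GmT_smul]
    | rw [GmGp_smul] | rw [GmGm_smul]
  all_goals norm_num [add_assoc, sub_eq_add_neg]

end

/-! ### Singular vectors at grade three -/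

/-- A vector of weight `(h, q, c)` annihilated by all positive modes. -/
structure IsHW {V : Type*} [AddCommGroup V] [Module U V] [Module ℂ V] [IsScalarTower ℂ U V]
    (h q c : ℂ) (v : V) : Prop where
  L_zero : op (gen (.L 0)) v = h • v
  T_zero : op (gen (.T 0)) v = q • v
  C : op (gen .C) v = c • v
  T_one : op (gen (.T 1)) v = 0
  Gp_zero : op (gen (.Gp 0)) v = 0
  Gm_zero : op (gen (.Gm 0)) v = 0

section

variable {V : Type*} [AddCommGroup V] [Module U V] [Module ℂ V] [IsScalarTower ℂ U V]
  {h q c : ℂ} {v : V}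

/-- The monomials are those of `psi32Terms`, in the same order. With the values in normal order,
later verifications only compare scalar coefficients. -/
lemma Gp_zero_smul_monomial (H : IsHW h q c v) :
    (op (gen (.Gp 0)) (op L₁ (op L₁ (op L₁ v))) = (3 : ℂ) • op L₁ (op L₁ (op P₁ v))) ∧
    (op (gen (.Gp 0)) (op L₃ v) = (2 : ℂ) • op P₅ v) ∧
    (op (gen (.Gp 0)) (op L₁ (op L₁ (op T₁ v))) = (-1 : ℂ) • op L₁ (op L₁ (op P₁ v)) + (2 : ℂ) • op L₁ (op T₁ (op P₁ v)) + (-2 : ℂ) • op L₁ (op P₃ v)) ∧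
    (op (gen (.Gp 0)) (op L₂ (op T₁ v)) = (-1 : ℂ) • op L₂ (op P₁ v) + (3/2 : ℂ) • op T₁ (op P₃ v) + (-3/2 : ℂ) • op P₅ v) ∧
    (op (gen (.Gp 0)) (op L₁ (op T₁ (op T₁ v))) = (-2 : ℂ) • op L₁ (op T₁ (op P₁ v)) + (1 : ℂ) • op L₁ (op P₃ v) + (1 : ℂ) • op T₁ (op T₁ (op P₁ v)) + (-2 : ℂ) • op T₁ (op P₃ v) + (1 : ℂ) • op P₅ v) ∧
    (op (gen (.Gp 0)) (op L₁ (op T₂ v)) = (-1 : ℂ) • op L₁ (op P₃ v) + (1 : ℂ) • op T₂ (op P₁ v) + (-1 : ℂ) • op P₅ v) ∧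
    (op (gen (.Gp 0)) (op L₂ (op L₁ v)) = (1 : ℂ) • op L₂ (op P₁ v) + (3/2 : ℂ) • op L₁ (op P₃ v) + (-3/2 : ℂ) • op P₅ v) ∧
    (op (gen (.Gp 0)) (op T₃ v) = (-1 : ℂ) • op P₅ v) ∧
    (op (gen (.Gp 0)) (op T₂ (op T₁ v)) = (-1 : ℂ) • op T₂ (op P₁ v) + (-1 : ℂ) • op T₁ (op P₃ v) + (1 : ℂ) • op P₅ v) ∧
    (op (gen (.Gp 0)) (op L₁ (op P₁ (op M₃ v))) = (-2 : ℂ) • op L₁ (op L₁ (op P₁ v)) + (-2 : ℂ) • op L₁ (op T₁ (op P₁ v)) + (2 : ℂ) • op L₁ (op P₃ v)) ∧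
    (op (gen (.Gp 0)) (op T₁ (op P₁ (op M₃ v))) = (-2 : ℂ) • op L₁ (op T₁ (op P₁ v)) + (2 : ℂ) • op T₂ (op P₁ v) + (-2 : ℂ) • op T₁ (op T₁ (op P₁ v)) + (2 : ℂ) • op T₁ (op P₃ v)) ∧
    (op (gen (.Gp 0)) (op P₁ (op M₅ v)) = (-2 : ℂ) • op L₂ (op P₁ v) + (2 : ℂ) • op P₅ v + (-3 : ℂ) • op T₂ (op P₁ v)) ∧
    (op (gen (.Gp 0)) (op L₁ (op P₃ (op M₁ v))) = (-2 * h + -1 * q : ℂ) • op L₁ (op P₃ v) + (1 : ℂ) • op P₁ (op P₃ (op M₁ v))) ∧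
    (op (gen (.Gp 0)) (op T₁ (op P₃ (op M₁ v))) = (-2 * h + -1 * q : ℂ) • op T₁ (op P₃ v) + (-1 : ℂ) • op P₁ (op P₃ (op M₁ v))) ∧
    (op (gen (.Gp 0)) (op P₅ (op M₁ v)) = (-2 * h + -1 * q : ℂ) • op P₅ v) ∧
    (op (gen (.Gp 0)) (op P₃ (op M₃ v)) = (-2 : ℂ) • op L₁ (op P₃ v) + (4 : ℂ) • op P₅ v + (-2 : ℂ) • op T₁ (op P₃ v)) ∧
    (op (gen (.Gp 0)) (op T₁ (op T₁ (op T₁ v))) = (-3 : ℂ) • op T₁ (op T₁ (op P₁ v)) + (3 : ℂ) • op T₁ (op P₃ v) + (-1 : ℂ) • op P₅ v) ∧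
    (op (gen (.Gp 0)) (op L₁ (op T₁ (op P₁ (op M₁ v)))) = (-2 * h + -1 * q : ℂ) • op L₁ (op T₁ (op P₁ v)) + (1 : ℂ) • op P₁ (op P₃ (op M₁ v))) ∧
    (op (gen (.Gp 0)) (op L₁ (op L₁ (op P₁ (op M₁ v)))) = (-2 * h + -1 * q : ℂ) • op L₁ (op L₁ (op P₁ v))) ∧
    (op (gen (.Gp 0)) (op L₂ (op P₁ (op M₁ v))) = (-2 * h + -1 * q : ℂ) • op L₂ (op P₁ v) + (-3/2 : ℂ) • op P₁ (op P₃ (op M₁ v))) ∧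
    (op (gen (.Gp 0)) (op T₁ (op T₁ (op P₁ (op M₁ v)))) = (-2 * h + -1 * q : ℂ) • op T₁ (op T₁ (op P₁ v)) + (-1 : ℂ) • op P₁ (op P₃ (op M₁ v))) ∧
    (op (gen (.Gp 0)) (op T₂ (op P₁ (op M₁ v))) = (-2 * h + -1 * q : ℂ) • op T₂ (op P₁ v) + (1 : ℂ) • op P₁ (op P₃ (op M₁ v))) := by
  and_intros <;>
    simp only [Gp_zero_smul_neg, Gm_zero_smul_neg, T_one_smul_neg, L_zero_smul_neg, T_zero_smul_neg, C_smul_neg, neg_smul_neg,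
      H.L_zero, H.T_zero, H.C, H.T_one, H.Gp_zero, H.Gm_zero, map_add, map_sub, map_neg, map_smul, map_zero] <;>
    module

lemma Gm_zero_smul_monomial (H : IsHW h q c v) :
    (op (gen (.Gm 0)) (op L₁ (op L₁ (op L₁ v))) = (3 : ℂ) • op L₁ (op L₁ (op M₁ v))) ∧
    (op (gen (.Gm 0)) (op L₃ v) = (2 : ℂ) • op M₅ v) ∧
    (op (gen (.Gm 0)) (op L₁ (op L₁ (op T₁ v))) = (1 : ℂ) • op L₁ (op L₁ (op M₁ v)) + (2 : ℂ) • op L₁ (op T₁ (op M₁ v)) + (2 : ℂ) • op L₁ (op M₃ v)) ∧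
    (op (gen (.Gm 0)) (op L₂ (op T₁ v)) = (1 : ℂ) • op L₂ (op M₁ v) + (3/2 : ℂ) • op T₁ (op M₃ v) + (3/2 : ℂ) • op M₅ v) ∧
    (op (gen (.Gm 0)) (op L₁ (op T₁ (op T₁ v))) = (2 : ℂ) • op L₁ (op T₁ (op M₁ v)) + (1 : ℂ) • op L₁ (op M₃ v) + (1 : ℂ) • op T₁ (op T₁ (op M₁ v)) + (2 : ℂ) • op T₁ (op M₃ v) + (1 : ℂ) • op M₅ v) ∧
    (op (gen (.Gm 0)) (op L₁ (op T₂ v)) = (1 : ℂ) • op L₁ (op M₃ v) + (1 : ℂ) • op T₂ (op M₁ v) + (1 : ℂ) • op M₅ v) ∧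
    (op (gen (.Gm 0)) (op L₂ (op L₁ v)) = (1 : ℂ) • op L₂ (op M₁ v) + (3/2 : ℂ) • op L₁ (op M₃ v) + (-3/2 : ℂ) • op M₅ v) ∧
    (op (gen (.Gm 0)) (op T₃ v) = (1 : ℂ) • op M₅ v) ∧
    (op (gen (.Gm 0)) (op T₂ (op T₁ v)) = (1 : ℂ) • op T₂ (op M₁ v) + (1 : ℂ) • op T₁ (op M₃ v) + (1 : ℂ) • op M₅ v) ∧
    (op (gen (.Gm 0)) (op L₁ (op P₁ (op M₃ v))) = (2 * h + 6 + -1 * q : ℂ) • op L₁ (op M₃ v) + (-1 : ℂ) • op P₁ (op M₁ (op M₃ v))) ∧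
    (op (gen (.Gm 0)) (op T₁ (op P₁ (op M₃ v))) = (2 * h + 4 + -1 * q : ℂ) • op T₁ (op M₃ v) + (-1 : ℂ) • op P₁ (op M₁ (op M₃ v)) + (2 : ℂ) • op L₁ (op M₃ v)) ∧
    (op (gen (.Gm 0)) (op P₁ (op M₅ v)) = (2 * h + 6 + -1 * q : ℂ) • op M₅ v) ∧
    (op (gen (.Gm 0)) (op L₁ (op P₃ (op M₁ v))) = (2 : ℂ) • op L₁ (op L₁ (op M₁ v)) + (-2 : ℂ) • op L₁ (op T₁ (op M₁ v)) + (2 : ℂ) • op L₂ (op M₁ v) + (-1 : ℂ) • op T₂ (op M₁ v)) ∧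
    (op (gen (.Gm 0)) (op T₁ (op P₃ (op M₁ v))) = (2 : ℂ) • op L₁ (op T₁ (op M₁ v)) + (-3 : ℂ) • op T₂ (op M₁ v) + (-2 : ℂ) • op T₁ (op T₁ (op M₁ v)) + (2 : ℂ) • op L₂ (op M₁ v)) ∧
    (op (gen (.Gm 0)) (op P₅ (op M₁ v)) = (2 : ℂ) • op L₂ (op M₁ v) + (-3 : ℂ) • op T₂ (op M₁ v)) ∧
    (op (gen (.Gm 0)) (op P₃ (op M₃ v)) = (2 : ℂ) • op L₁ (op M₃ v) + (-2 : ℂ) • op T₁ (op M₃ v)) ∧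
    (op (gen (.Gm 0)) (op T₁ (op T₁ (op T₁ v))) = (3 : ℂ) • op T₁ (op T₁ (op M₁ v)) + (3 : ℂ) • op T₁ (op M₃ v) + (1 : ℂ) • op M₅ v) ∧
    (op (gen (.Gm 0)) (op L₁ (op T₁ (op P₁ (op M₁ v)))) = (2 * h + 4 + -1 * q : ℂ) • op L₁ (op T₁ (op M₁ v)) + (2 : ℂ) • op L₁ (op L₁ (op M₁ v)) + (-1 : ℂ) • op T₂ (op M₁ v) + (1 : ℂ) • op P₁ (op M₁ (op M₃ v)) + (2 : ℂ) • op L₂ (op M₁ v)) ∧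
    (op (gen (.Gm 0)) (op L₁ (op L₁ (op P₁ (op M₁ v)))) = (2 * h + 6 + -1 * q : ℂ) • op L₁ (op L₁ (op M₁ v))) ∧
    (op (gen (.Gm 0)) (op L₂ (op P₁ (op M₁ v))) = (2 * h + 5 + -1 * q : ℂ) • op L₂ (op M₁ v) + (3/2 : ℂ) • op P₁ (op M₁ (op M₃ v)) + (3/2 : ℂ) • op T₂ (op M₁ v)) ∧
    (op (gen (.Gm 0)) (op T₁ (op T₁ (op P₁ (op M₁ v)))) = (2 * h + 2 + -1 * q : ℂ) • op T₁ (op T₁ (op M₁ v)) + (4 : ℂ) • op L₁ (op T₁ (op M₁ v)) + (-3 : ℂ) • op T₂ (op M₁ v) + (1 : ℂ) • op P₁ (op M₁ (op M₃ v)) + (2 : ℂ) • op L₂ (op M₁ v)) ∧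
    (op (gen (.Gm 0)) (op T₂ (op P₁ (op M₁ v))) = (2 * h + 3 + -1 * q : ℂ) • op T₂ (op M₁ v) + (1 : ℂ) • op P₁ (op M₁ (op M₃ v)) + (2 : ℂ) • op L₂ (op M₁ v)) := by
  and_intros <;>
    simp only [Gp_zero_smul_neg, Gm_zero_smul_neg, T_one_smul_neg, L_zero_smul_neg, T_zero_smul_neg, C_smul_neg, neg_smul_neg,
      H.L_zero, H.T_zero, H.C, H.T_one, H.Gp_zero, H.Gm_zero, map_add, map_sub, map_neg, map_smul, map_zero] <;>
    module

lemma T_one_smul_monomial (H : IsHW h q c v) :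
    (op (gen (.T 1)) (op L₁ (op L₁ (op L₁ v))) = (3 * q : ℂ) • op L₁ (op L₁ v)) ∧
    (op (gen (.T 1)) (op L₃ v) = (1 : ℂ) • op T₂ v) ∧
    (op (gen (.T 1)) (op L₁ (op L₁ (op T₁ v))) = (1/3 * c : ℂ) • op L₁ (op L₁ v) + (2 * q : ℂ) • op L₁ (op T₁ v)) ∧
    (op (gen (.T 1)) (op L₂ (op T₁ v)) = (1/3 * c : ℂ) • op L₂ v + (1 : ℂ) • op T₁ (op T₁ v)) ∧
    (op (gen (.T 1)) (op L₁ (op T₁ (op T₁ v))) = (2/3 * c : ℂ) • op L₁ (op T₁ v) + (1 * q : ℂ) • op T₁ (op T₁ v)) ∧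
    (op (gen (.T 1)) (op L₁ (op T₂ v)) = (1 * q : ℂ) • op T₂ v) ∧
    (op (gen (.T 1)) (op L₂ (op L₁ v)) = (1 * q : ℂ) • op L₂ v + (1 : ℂ) • op L₁ (op T₁ v) + (-1 : ℂ) • op T₂ v) ∧
    (op (gen (.T 1)) (op T₃ v) = 0) ∧
    (op (gen (.T 1)) (op T₂ (op T₁ v)) = (1/3 * c : ℂ) • op T₂ v) ∧
    (op (gen (.T 1)) (op L₁ (op P₁ (op M₃ v))) = (-1 : ℂ) • op L₁ (op P₁ (op M₁ v)) + (2 : ℂ) • op L₁ (op L₁ v) + (2 : ℂ) • op L₁ (op T₁ v) + (1 * q : ℂ) • op P₁ (op M₃ v)) ∧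
    (op (gen (.T 1)) (op T₁ (op P₁ (op M₃ v))) = (-1 : ℂ) • op T₁ (op P₁ (op M₁ v)) + (2 : ℂ) • op L₁ (op T₁ v) + (-2 : ℂ) • op T₂ v + (2 : ℂ) • op T₁ (op T₁ v) + (1/3 * c : ℂ) • op P₁ (op M₃ v)) ∧
    (op (gen (.T 1)) (op P₁ (op M₅ v)) = (-1 : ℂ) • op P₁ (op M₃ v) + (2 : ℂ) • op L₂ v + (3 : ℂ) • op T₂ v) ∧
    (op (gen (.T 1)) (op L₁ (op P₃ (op M₁ v))) = (1 : ℂ) • op L₁ (op P₁ (op M₁ v)) + (1 * q : ℂ) • op P₃ (op M₁ v)) ∧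
    (op (gen (.T 1)) (op T₁ (op P₃ (op M₁ v))) = (1 : ℂ) • op T₁ (op P₁ (op M₁ v)) + (1/3 * c : ℂ) • op P₃ (op M₁ v)) ∧
    (op (gen (.T 1)) (op P₅ (op M₁ v)) = (1 : ℂ) • op P₃ (op M₁ v)) ∧
    (op (gen (.T 1)) (op P₃ (op M₃ v)) = (-1 : ℂ) • op P₃ (op M₁ v) + (1 : ℂ) • op P₁ (op M₃ v)) ∧
    (op (gen (.T 1)) (op T₁ (op T₁ (op T₁ v))) = (1 * c : ℂ) • op T₁ (op T₁ v)) ∧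
    (op (gen (.T 1)) (op L₁ (op T₁ (op P₁ (op M₁ v)))) = (2 * h + 1 * q : ℂ) • op L₁ (op T₁ v) + (1/3 * c : ℂ) • op L₁ (op P₁ (op M₁ v)) + (1 * q : ℂ) • op T₁ (op P₁ (op M₁ v))) ∧
    (op (gen (.T 1)) (op L₁ (op L₁ (op P₁ (op M₁ v)))) = (2 * h + 1 * q : ℂ) • op L₁ (op L₁ v) + (2 * q : ℂ) • op L₁ (op P₁ (op M₁ v))) ∧
    (op (gen (.T 1)) (op L₂ (op P₁ (op M₁ v))) = (2 * h + 1 * q : ℂ) • op L₂ v + (1 : ℂ) • op T₁ (op P₁ (op M₁ v))) ∧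
    (op (gen (.T 1)) (op T₁ (op T₁ (op P₁ (op M₁ v)))) = (2 * h + 1 * q : ℂ) • op T₁ (op T₁ v) + (2/3 * c : ℂ) • op T₁ (op P₁ (op M₁ v))) ∧
    (op (gen (.T 1)) (op T₂ (op P₁ (op M₁ v))) = (2 * h + 1 * q : ℂ) • op T₂ v) := by
  and_intros <;>
    simp only [Gp_zero_smul_neg, Gm_zero_smul_neg, T_one_smul_neg, L_zero_smul_neg, T_zero_smul_neg, C_smul_neg, neg_smul_neg,
      H.L_zero, H.T_zero, H.C, H.T_one, H.Gp_zero, H.Gm_zero, map_add, map_sub, map_neg, map_smul, map_zero] <;>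
    module

lemma L_zero_smul_monomial (H : IsHW h q c v) :
    (op (gen (.L 0)) (op L₁ (op L₁ (op L₁ v))) = (h + 3) • op L₁ (op L₁ (op L₁ v))) ∧
    (op (gen (.L 0)) (op L₃ v) = (h + 3) • op L₃ v) ∧
    (op (gen (.L 0)) (op L₁ (op L₁ (op T₁ v))) = (h + 3) • op L₁ (op L₁ (op T₁ v))) ∧
    (op (gen (.L 0)) (op L₂ (op T₁ v)) = (h + 3) • op L₂ (op T₁ v)) ∧
    (op (gen (.L 0)) (op L₁ (op T₁ (op T₁ v))) = (h + 3) • op L₁ (op T₁ (op T₁ v))) ∧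
    (op (gen (.L 0)) (op L₁ (op T₂ v)) = (h + 3) • op L₁ (op T₂ v)) ∧
    (op (gen (.L 0)) (op L₂ (op L₁ v)) = (h + 3) • op L₂ (op L₁ v)) ∧
    (op (gen (.L 0)) (op T₃ v) = (h + 3) • op T₃ v) ∧
    (op (gen (.L 0)) (op T₂ (op T₁ v)) = (h + 3) • op T₂ (op T₁ v)) ∧
    (op (gen (.L 0)) (op L₁ (op P₁ (op M₃ v))) = (h + 3) • op L₁ (op P₁ (op M₃ v))) ∧
    (op (gen (.L 0)) (op T₁ (op P₁ (op M₃ v))) = (h + 3) • op T₁ (op P₁ (op M₃ v))) ∧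
    (op (gen (.L 0)) (op P₁ (op M₅ v)) = (h + 3) • op P₁ (op M₅ v)) ∧
    (op (gen (.L 0)) (op L₁ (op P₃ (op M₁ v))) = (h + 3) • op L₁ (op P₃ (op M₁ v))) ∧
    (op (gen (.L 0)) (op T₁ (op P₃ (op M₁ v))) = (h + 3) • op T₁ (op P₃ (op M₁ v))) ∧
    (op (gen (.L 0)) (op P₅ (op M₁ v)) = (h + 3) • op P₅ (op M₁ v)) ∧
    (op (gen (.L 0)) (op P₃ (op M₃ v)) = (h + 3) • op P₃ (op M₃ v)) ∧
    (op (gen (.L 0)) (op T₁ (op T₁ (op T₁ v))) = (h + 3) • op T₁ (op T₁ (op T₁ v))) ∧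
    (op (gen (.L 0)) (op L₁ (op T₁ (op P₁ (op M₁ v)))) = (h + 3) • op L₁ (op T₁ (op P₁ (op M₁ v)))) ∧
    (op (gen (.L 0)) (op L₁ (op L₁ (op P₁ (op M₁ v)))) = (h + 3) • op L₁ (op L₁ (op P₁ (op M₁ v)))) ∧
    (op (gen (.L 0)) (op L₂ (op P₁ (op M₁ v))) = (h + 3) • op L₂ (op P₁ (op M₁ v))) ∧
    (op (gen (.L 0)) (op T₁ (op T₁ (op P₁ (op M₁ v)))) = (h + 3) • op T₁ (op T₁ (op P₁ (op M₁ v)))) ∧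
    (op (gen (.L 0)) (op T₂ (op P₁ (op M₁ v))) = (h + 3) • op T₂ (op P₁ (op M₁ v))) := by
  and_intros <;>
    simp only [Gp_zero_smul_neg, Gm_zero_smul_neg, T_one_smul_neg, L_zero_smul_neg, T_zero_smul_neg, C_smul_neg, neg_smul_neg,
      H.L_zero, H.T_zero, H.C, H.T_one, H.Gp_zero, H.Gm_zero, map_add, map_sub, map_neg, map_smul, map_zero] <;>
    module

lemma T_zero_smul_monomial (H : IsHW h q c v) :
    (op (gen (.T 0)) (op L₁ (op L₁ (op L₁ v))) = q • op L₁ (op L₁ (op L₁ v))) ∧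
    (op (gen (.T 0)) (op L₃ v) = q • op L₃ v) ∧
    (op (gen (.T 0)) (op L₁ (op L₁ (op T₁ v))) = q • op L₁ (op L₁ (op T₁ v))) ∧
    (op (gen (.T 0)) (op L₂ (op T₁ v)) = q • op L₂ (op T₁ v)) ∧
    (op (gen (.T 0)) (op L₁ (op T₁ (op T₁ v))) = q • op L₁ (op T₁ (op T₁ v))) ∧
    (op (gen (.T 0)) (op L₁ (op T₂ v)) = q • op L₁ (op T₂ v)) ∧
    (op (gen (.T 0)) (op L₂ (op L₁ v)) = q • op L₂ (op L₁ v)) ∧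
    (op (gen (.T 0)) (op T₃ v) = q • op T₃ v) ∧
    (op (gen (.T 0)) (op T₂ (op T₁ v)) = q • op T₂ (op T₁ v)) ∧
    (op (gen (.T 0)) (op L₁ (op P₁ (op M₃ v))) = q • op L₁ (op P₁ (op M₃ v))) ∧
    (op (gen (.T 0)) (op T₁ (op P₁ (op M₃ v))) = q • op T₁ (op P₁ (op M₃ v))) ∧
    (op (gen (.T 0)) (op P₁ (op M₅ v)) = q • op P₁ (op M₅ v)) ∧
    (op (gen (.T 0)) (op L₁ (op P₃ (op M₁ v))) = q • op L₁ (op P₃ (op M₁ v))) ∧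
    (op (gen (.T 0)) (op T₁ (op P₃ (op M₁ v))) = q • op T₁ (op P₃ (op M₁ v))) ∧
    (op (gen (.T 0)) (op P₅ (op M₁ v)) = q • op P₅ (op M₁ v)) ∧
    (op (gen (.T 0)) (op P₃ (op M₃ v)) = q • op P₃ (op M₃ v)) ∧
    (op (gen (.T 0)) (op T₁ (op T₁ (op T₁ v))) = q • op T₁ (op T₁ (op T₁ v))) ∧
    (op (gen (.T 0)) (op L₁ (op T₁ (op P₁ (op M₁ v)))) = q • op L₁ (op T₁ (op P₁ (op M₁ v)))) ∧
    (op (gen (.T 0)) (op L₁ (op L₁ (op P₁ (op M₁ v)))) = q • op L₁ (op L₁ (op P₁ (op M₁ v)))) ∧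
    (op (gen (.T 0)) (op L₂ (op P₁ (op M₁ v))) = q • op L₂ (op P₁ (op M₁ v))) ∧
    (op (gen (.T 0)) (op T₁ (op T₁ (op P₁ (op M₁ v)))) = q • op T₁ (op T₁ (op P₁ (op M₁ v)))) ∧
    (op (gen (.T 0)) (op T₂ (op P₁ (op M₁ v))) = q • op T₂ (op P₁ (op M₁ v))) := by
  and_intros <;>
    simp only [Gp_zero_smul_neg, Gm_zero_smul_neg, T_one_smul_neg, L_zero_smul_neg, T_zero_smul_neg, C_smul_neg, neg_smul_neg,
      H.L_zero, H.T_zero, H.C, H.T_one, H.Gp_zero, H.Gm_zero, map_add, map_sub, map_neg, map_smul, map_zero] <;>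
    module

end

/-! ### Reduction of the highest weight conditions to three operators -/

section

variable {V : Type*} [AddCommGroup V] [Module U V] [Module ℂ V] [IsScalarTower ℂ U V]
  {h q c : ℂ} {v : V}

/-- The operators of unit index generate all positive modes. -/
lemma pos_smul_eq_zero (hp : op (gen (.Gp 0)) v = 0) (hm : op (gen (.Gm 0)) v = 0)
    (ht : op (gen (.T 1)) v = 0) (k : ℕ) :
    gen (.Gp k) • v = 0 ∧ gen (.Gm k) • v = 0 ∧ gen (.L (k + 1)) • v = 0 ∧
      gen (.T (k + 1)) • v = 0 := by
  simp only [op_apply] at hp hm ht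
  have hG : ∀ k : ℕ, gen (.Gp k) • v = 0 ∧ gen (.Gm k) • v = 0 := by
    intro k
    induction k with
    | zero => exact ⟨hp, hm⟩
    | succ k ih =>
      -- Bracketing with T_1 raises the index of G^± by one.
      have e1 := TGp_smul 1 k v
      have e2 := TGm_smul 1 k v
      rw [ht, ih.1, smul_zero, smul_zero, zero_add] at e1
      rw [ht, ih.2, smul_zero, smul_zero, zero_add] at e2
      push_cast
      rw [add_comm (k : ℤ) 1]
      exact ⟨e1.symm, neg_eq_zero.1 e2.symm⟩
  -- The anticommutators of G⁺_{k+1/2} with G⁻_{1/2} and of G⁺_{1/2} with G⁻_{k+1/2} are 2L_{k+1} ±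
  -- kT_{k+1}. Their sum isolates L_{k+1}, and then either one gives kT_{k+1}.
  have e1 := GpGm_smul k 0 v
  have e2 := GpGm_smul 0 k v
  have hk : ¬ (k : ℤ) + 1 = 0 := by omega
  simp only [hp, hm, (hG k).1, (hG k).2, smul_zero, neg_zero, zero_add, add_zero, hk, if_false,
    zero_smul] at e1 e2
  generalize gen (.L ((k : ℤ) + 1)) • v = x at e1 e2 ⊢
  generalize hy : gen (.T ((k : ℤ) + 1)) • v = y at e1 e2 ⊢
  have hx : (4 : ℂ) • x = 0 := by
    linear_combination (norm := (push_cast; module)) -e1 - e2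
  have hx := (smul_eq_zero.1 hx).resolve_left (by norm_num)
  refine ⟨(hG k).1, (hG k).2, hx, ?_⟩
  -- At k = 0 the coefficient of T_1 vanishes, which is why T_1 has to be assumed separately.
  rcases Nat.eq_zero_or_pos k with rfl | hk
  · rw [← hy]; simpa using ht
  · have hy : (k : ℂ) • y = 0 := by
      linear_combination (norm := (push_cast; module)) -e1 - (2 : ℂ) • hx
    exact (smul_eq_zero.1 hy).resolve_left (by exact_mod_cast hk.ne')

end

section

variable {h q c : ℂ}

lemma satisfiesHW_of {n : ℚ} {p : ℤ} {v : Verma h q c}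
    (weight : op (gen (.L 0)) v = (h + (n : ℂ)) • v)
    (charge : op (gen (.T 0)) v = (q + (p : ℂ)) • v) (hp : op (gen (.Gp 0)) v = 0)
    (hm : op (gen (.Gm 0)) v = 0) (ht : op (gen (.T 1)) v = 0) : SatisfiesHW h q c n p v where
  weight := weight
  charge := charge
  L_pos m hm' := by
    obtain ⟨k, rfl⟩ := Int.eq_succ_of_zero_lt hm'
    simpa using (pos_smul_eq_zero hp hm ht k).2.2.1
  T_pos m hm' := by
    obtain ⟨k, rfl⟩ := Int.eq_succ_of_zero_lt hm'
    simpa using (pos_smul_eq_zero hp hm ht k).2.2.2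
  Gp_pos m hm' := by
    obtain ⟨k, rfl⟩ := Int.eq_ofNat_of_zero_le hm'
    exact (pos_smul_eq_zero hp hm ht k).1
  Gm_pos m hm' := by
    obtain ⟨k, rfl⟩ := Int.eq_ofNat_of_zero_le hm'
    exact (pos_smul_eq_zero hp hm ht k).2.1

variable (h q c) in
lemma isHW_hw : IsHW h q c (hw h q c) := by
  have H : ∀ u ∈ vermaIdeal h q c, u • hw h q c = 0 := by
    intro u hu
    rw [hw, ← Submodule.Quotient.mk_smul, Submodule.Quotient.mk_eq_zero, smul_eq_mul, mul_one]
    exact hu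
  have H' : ∀ (u : U) (a : ℂ), u - algebraMap ℂ U a ∈ vermaIdeal h q c →
      u • hw h q c = a • hw h q c := by
    intro u a hu
    rw [← algebraMap_smul U a (hw h q c)]
    exact sub_eq_zero.1 ((sub_smul u (algebraMap ℂ U a) (hw h q c)).symm.trans (H _ hu))
  exact
    { L_zero := H' _ _ (Submodule.subset_span (by simp))
      T_zero := H' _ _ (Submodule.subset_span (by simp))
      C := H' _ _ (Submodule.subset_span (by simp))
      T_one := H _ (Submodule.subset_span (.inl (.inl ⟨1, one_pos, .inr rfl⟩)))
      Gp_zero := H _ (Submodule.subset_span (.inl (.inr ⟨0, le_rfl, .inl rfl⟩)))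
      Gm_zero := H _ (Submodule.subset_span (.inl (.inr ⟨0, le_rfl, .inr rfl⟩))) }

end

/-! ### Highest weight conditions for the family and on the two lines -/

section

variable {V : Type*} [AddCommGroup V] [Module U V] [Module ℂ V] [IsScalarTower ℂ U V]

lemma op_add (x y : U) (v : V) : op (x + y) v = op x v + op y v := add_smul x y v

lemma op_sub (x y : U) (v : V) : op (x - y) v = op x v - op y v := sub_smul x y v

lemma op_mul (x y : U) (v : V) : op (x * y) v = op x (op y v) := mul_smul x y v

lemma op_smul (a : ℂ) (x : U) (v : V) : op (a • x) v = a • op x v := smul_assoc a x v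

lemma op_pow_two (x : U) (v : V) : op (x ^ 2) v = op x (op x v) := by rw [pow_two, op_mul]

lemma op_pow_three (x : U) (v : V) : op (x ^ 3) v = op x (op x (op x v)) := by
  rw [pow_succ, op_mul, op_pow_two]

lemma op_zero (v : V) : op 0 v = 0 := zero_smul U v

variable {v : V} {t q : ℂ}

/-- On this line h, q and c are polynomial in t, so no denominators occur and t = 0 is included. -/
lemma delta01_isHW (H : IsHW ((t - 1) / 2) (t - 1) (3 - 3 * t) v) :
    op (gen (.L 0)) (op (delta01 t) v) = ((t - 1) / 2 + 3) • op (delta01 t) v ∧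
    op (gen (.T 0)) (op (delta01 t) v) = (t - 1) • op (delta01 t) v ∧
    op (gen (.Gp 0)) (op (delta01 t) v) = 0 ∧ op (gen (.Gm 0)) (op (delta01 t) v) = 0 ∧
    op (gen (.T 1)) (op (delta01 t) v) = 0 := by
  simp only [delta01, op_add, op_sub, op_mul, op_smul, op_pow_two, op_pow_three, map_add, map_sub,
    map_smul, L_zero_smul_monomial H, T_zero_smul_monomial H, Gp_zero_smul_monomial H,
    Gm_zero_smul_monomial H, T_one_smul_monomial H]
  refine ⟨?_, ?_, ?_, ?_, ?_⟩ <;> module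

lemma delta10_isHW (H : IsHW ((t - 1) / 2) (1 - t) (3 - 3 * t) v) :
    op (gen (.L 0)) (op (delta10 t) v) = ((t - 1) / 2 + 3) • op (delta10 t) v ∧
    op (gen (.T 0)) (op (delta10 t) v) = (1 - t) • op (delta10 t) v ∧
    op (gen (.Gp 0)) (op (delta10 t) v) = 0 ∧ op (gen (.Gm 0)) (op (delta10 t) v) = 0 ∧
    op (gen (.T 1)) (op (delta10 t) v) = 0 := by
  simp only [delta10, op_add, op_sub, op_mul, op_smul, op_pow_two, op_pow_three, map_add, map_sub,
    map_smul, L_zero_smul_monomial H, T_zero_smul_monomial H, Gp_zero_smul_monomial H,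
    Gm_zero_smul_monomial H, T_one_smul_monomial H]
  refine ⟨?_, ?_, ?_, ?_, ?_⟩ <;> module

/-- Pulling out the common factor lowers the degree of the identities to be checked. -/
lemma op_psi32 (v : V) : op (psi32 t q) v =
    (2 ^ 6 * (q + t) * (q - t)) • (psi32Terms.map fun x => x.2 t q • op x.1 v).sum := by
  simp only [psi32, psi32Terms, List.map_cons, List.map_nil, List.sum_cons, List.sum_nil, op_add,
    op_smul, op_zero, smul_add, smul_zero, smul_smul]

lemma psi32_isHW (ht : t ≠ 0) (H : IsHW (hParam 3 2 t q) q (cParam t) v) :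
    op (gen (.L 0)) (op (psi32 t q) v) = (hParam 3 2 t q + 3) • op (psi32 t q) v ∧
    op (gen (.T 0)) (op (psi32 t q) v) = q • op (psi32 t q) v ∧
    op (gen (.Gp 0)) (op (psi32 t q) v) = 0 ∧ op (gen (.Gm 0)) (op (psi32 t q) v) = 0 ∧
    op (gen (.T 1)) (op (psi32 t q) v) = 0 := by
  -- A form of the weight with the single denominator 2t, so that clearing denominators leaves
  -- polynomial identities.
  have hh : hParam 3 2 t q = ((1 - t) * (1 - 2 * t) - q ^ 2) / (2 * t) := by
    rw [hParam]; field_simp; ring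
  rw [hh] at H ⊢
  rw [cParam] at H
  simp only [op_psi32, map_smul, smul_comm _ (2 ^ 6 * (q + t) * (q - t))]
  simp only [psi32Terms, List.map_cons, List.map_nil, List.sum_cons, List.sum_nil, op_add, op_sub,
    op_mul, op_smul, op_pow_two, op_pow_three, map_add, map_smul, map_zero,
    L_zero_smul_monomial H, T_zero_smul_monomial H, Gp_zero_smul_monomial H,
    Gm_zero_smul_monomial H, T_one_smul_monomial H]
  refine ⟨?_, ?_, ?_, ?_, ?_⟩
  · congr 1; module
  · congr 1; module
  all_goals
    refine smul_eq_zero_of_right _ ?_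
    match_scalars <;> field_simp <;> ring

end

/-! ### Identities between the operators -/

lemma psi32_one_zero : psi32 1 0 = 0 := by
  simp only [psi32, psi32Terms, List.map_cons, List.map_nil, List.sum_cons, List.sum_nil]
  match_scalars <;> norm_num

lemma psi32_line01 (t : ℂ) : psi32 t (t - 1) =
    (2 ^ 6 * t ^ 3 * (2 * t - 1) * (t - 1) * (t - 2)) • delta01 t := by
  simp only [psi32, psi32Terms, List.map_cons, List.map_nil, List.sum_cons, List.sum_nil, delta01]
  match_scalars <;> ring

lemma psi32_line10 (t : ℂ) : psi32 t (1 - t) =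
    (-(2 ^ 6 * t ^ 3 * (2 * t - 1) * (t - 1) * (t - 2))) • delta10 t := by
  simp only [psi32, psi32Terms, List.map_cons, List.map_nil, List.sum_cons, List.sum_nil, delta10]
  match_scalars <;> ring

/-- Acting on 1 in the left regular module makes the reordering rules, stated for modules, available
for identities in `U` itself. -/
lemma op_one (u : U) : op u (1 : U) = u := mul_one u

lemma delta01_eq (t : ℂ) : delta01 t = thetaMinus t t * P₁ := by
  rw [← op_one (delta01 t), ← op_one (thetaMinus t t * P₁)]
  simp only [delta01, thetaMinus, op_add, op_sub, op_mul, op_smul, op_pow_two, op_pow_three,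
    neg_smul_neg, map_add, map_sub, map_neg, map_smul, map_zero]
  module

lemma delta10_eq (t : ℂ) : delta10 t = thetaPlus t (-t) * M₁ := by
  rw [← op_one (delta10 t), ← op_one (thetaPlus t (-t) * M₁)]
  simp only [delta10, thetaPlus, op_add, op_sub, op_mul, op_smul, op_pow_two, op_pow_three,
    neg_smul_neg, map_add, map_sub, map_neg, map_smul, map_zero]
  module

/-- The derivative is linear in (a,b), and its values at (1,1) and (1,-1) agree with differentiating
the factor t-1 in `psi32_line01` and `psi32_line10`. The proof differentiates each coefficient
directly. -/
lemma psi32Deriv_one_zero (a b : ℂ) : psi32Deriv 1 0 a b =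
    (-32 * (a + b)) • delta01 1 + (32 * (a - b)) • delta10 1 := by
  simp only [psi32Deriv, psi32Terms, List.map_cons, List.map_nil, List.sum_cons, List.sum_nil]
  simp (disch := fun_prop) only [deriv_fun_add, deriv_fun_sub, deriv_fun_mul, deriv_fun_pow,
    deriv_const, deriv_id'', deriv.fun_neg']
  simp only [delta01, delta10]
  match_scalars <;> push_cast <;> ring

/-! ### Singularity and linear independence -/

section

variable {h q c : ℂ}

/-- A multiple of the highest weight vector has L_0-weight h; if it also has weight h + n with n
nonzero, it vanishes, contrary to detection. -/
lemma isSingular_of_detect {u : U} {n : ℚ} {p : ℤ} (hn : n ≠ 0)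
    (H : SatisfiesHW h q c n p (u • hw h q c)) (hu : detect h q c u ≠ 0) :
    IsSingular h q c n p (u • hw h q c) := by
  refine ⟨H, fun a ha => hu (detect_eq_zero ?_)⟩
  have e1 := H.weight
  have e2 : gen (.L 0) • hw h q c = h • hw h q c := (isHW_hw h q c).L_zero
  have e3 : op (gen (.L 0)) (a • hw h q c) = a • op (gen (.L 0)) (hw h q c) := map_smul _ _ _
  rw [op_apply, op_apply, e2] at e3
  rw [ha, e3] at e1
  have e4 : (n : ℂ) • a • hw h q c = 0 := by
    linear_combination (norm := module) -e1
  rw [ha]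
  exact (smul_eq_zero.1 e4).resolve_left (by exact_mod_cast hn)

lemma psi32_satisfiesHW {t : ℂ} (ht : t ≠ 0) (q : ℂ) :
    SatisfiesHW (hParam 3 2 t q) q (cParam t) 3 0
      (psi32 t q • hw (hParam 3 2 t q) q (cParam t)) := by
  obtain ⟨h1, h2, h3, h4, h5⟩ := psi32_isHW ht (isHW_hw (hParam 3 2 t q) q (cParam t))
  exact satisfiesHW_of (by simpa [op_apply] using h1) (by simpa [op_apply] using h2) h3 h4 h5

lemma delta01_isSingular (t : ℂ) : IsSingular ((t - 1) / 2) (t - 1) (3 - 3 * t) 3 0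
    (delta01 t • hw ((t - 1) / 2) (t - 1) (3 - 3 * t)) := by
  obtain ⟨h1, h2, h3, h4, h5⟩ := delta01_isHW (isHW_hw ((t - 1) / 2) (t - 1) (3 - 3 * t))
  refine isSingular_of_detect three_ne_zero
    (satisfiesHW_of (by simpa [op_apply] using h1) (by simpa [op_apply] using h2) h3 h4 h5) ?_
  rw [detect_delta01]
  intro e
  simpa using congrFun (congrFun e 1) 1

lemma delta10_isSingular (t : ℂ) : IsSingular ((t - 1) / 2) (1 - t) (3 - 3 * t) 3 0
    (delta10 t • hw ((t - 1) / 2) (1 - t) (3 - 3 * t)) := by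
  obtain ⟨h1, h2, h3, h4, h5⟩ := delta10_isHW (isHW_hw ((t - 1) / 2) (1 - t) (3 - 3 * t))
  refine isSingular_of_detect three_ne_zero
    (satisfiesHW_of (by simpa [op_apply] using h1) (by simpa [op_apply] using h2) h3 h4 h5) ?_
  rw [detect_delta10]
  intro e
  simpa using congrFun (congrFun e 0) 0

/-- The two images are independent diagonal matrices. The weight is arbitrary because independence
involves only negative modes. -/
lemma linearIndependent_delta (t : ℂ) :
    LinearIndependent ℂ ![delta01 t • hw h q c, delta10 t • hw h q c] := by
  refine LinearIndependent.pair_iff.2 fun a b hab => ?_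
  have e : (a • delta01 t + b • delta10 t) • hw h q c = 0 := by
    have e1 := op_add (a • delta01 t) (b • delta10 t) (hw h q c)
    rw [op_smul, op_smul] at e1
    exact e1.trans hab
  have e := detect_eq_zero e
  rw [map_add, map_smul, map_smul, detect_delta01, detect_delta10] at e
  have e0 := congrFun (congrFun e 0) 0
  have e1 := congrFun (congrFun e 1) 1
  simp at e0 e1
  exact ⟨e1, e0⟩

end

end N2

end

/-! ### Assembly and the failure of uniqueness -/

theorem mainTheorem8 :
    -- the vector of the family lies in the Verma module with `h = h_{3,2}(t,q)`, `c = c(t)`, and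
    -- satisfies the highest weight conditions there, at grade 3 with charge 0
    (∀ t q : ℂ, t ≠ 0 →
      N2.SatisfiesHW (N2.hParam 3 2 t q) q (N2.cParam t) 3 0
        (N2.psi32 t q • N2.hw (N2.hParam 3 2 t q) q (N2.cParam t))) ∧
    -- at `(t,q) = (1,0)` the module is `V_{0,0,0}` and the vector vanishes identically
    (N2.hParam 3 2 1 0 = 0 ∧ N2.cParam 1 = 0 ∧
      N2.psi32 1 0 = 0 ∧ N2.psi32 1 0 • N2.hw 0 0 0 = 0) ∧
    -- the line `q = t - 1`
    (∀ t : ℂ,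
      (t ≠ 0 → N2.hParam 3 2 t (t - 1) = (t - 1) / 2) ∧
      N2.psi32 t (t - 1) =
        (2 ^ 6 * t ^ 3 * (2 * t - 1) * (t - 1) * (t - 2)) • N2.delta01 t ∧
      N2.delta01 t = N2.thetaMinus t t * N2.P₁ ∧
      N2.IsSingular ((t - 1) / 2) (t - 1) (3 - 3 * t) 3 0
        (N2.delta01 t • N2.hw ((t - 1) / 2) (t - 1) (3 - 3 * t))) ∧
    -- the line `q = 1 - t`
    (∀ t : ℂ,
      (t ≠ 0 → N2.hParam 3 2 t (1 - t) = (t - 1) / 2) ∧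
      N2.psi32 t (1 - t) =
        (-(2 ^ 6 * t ^ 3 * (2 * t - 1) * (t - 1) * (t - 2))) • N2.delta10 t ∧
      N2.delta10 t = N2.thetaPlus t (-t) * N2.M₁ ∧
      N2.IsSingular ((t - 1) / 2) (1 - t) (3 - 3 * t) 3 0
        (N2.delta10 t • N2.hw ((t - 1) / 2) (1 - t) (3 - 3 * t))) ∧
    -- the tangent space of the family at `(1,0)`
    (∀ a b : ℂ, N2.psi32Deriv 1 0 a b =
      (-32 * (a + b)) • N2.delta01 1 + (32 * (a - b)) • N2.delta10 1) ∧
    -- two linearly independent uncharged singular vectors at grade 3 of `V_{0,0,0}`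
    (N2.IsSingular 0 0 0 3 0 (N2.delta01 1 • N2.hw 0 0 0) ∧
      N2.IsSingular 0 0 0 3 0 (N2.delta10 1 • N2.hw 0 0 0) ∧
      LinearIndependent ℂ ![N2.delta01 1 • N2.hw 0 0 0, N2.delta10 1 • N2.hw 0 0 0]) ∧
    -- the uniqueness built into the conjectured embedding diagrams fails
    ¬ N2.SingularVectorsUnique := by
  have s01 : N2.IsSingular 0 0 0 3 0 (N2.delta01 1 • N2.hw 0 0 0) := by
    -- The Verma module is a type depending on the weight, so the parameters are generalised and
    -- substituted instead of being rewritten in place.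
    have e : ∀ h q c : ℂ, h = (1 - 1) / 2 → q = 1 - 1 → c = 3 - 3 * 1 →
        N2.IsSingular h q c 3 0 (N2.delta01 1 • N2.hw h q c) := by
      rintro _ _ _ rfl rfl rfl
      exact N2.delta01_isSingular 1
    exact e 0 0 0 (by norm_num) (by norm_num) (by norm_num)
  have s10 : N2.IsSingular 0 0 0 3 0 (N2.delta10 1 • N2.hw 0 0 0) := by
    have e : ∀ h q c : ℂ, h = (1 - 1) / 2 → q = 1 - 1 → c = 3 - 3 * 1 →
        N2.IsSingular h q c 3 0 (N2.delta10 1 • N2.hw h q c) := by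
      rintro _ _ _ rfl rfl rfl
      exact N2.delta10_isSingular 1
    exact e 0 0 0 (by norm_num) (by norm_num) (by norm_num)
  refine ⟨fun t q ht => N2.psi32_satisfiesHW ht q, ⟨by norm_num [N2.hParam], by norm_num [N2.cParam],
      N2.psi32_one_zero, by rw [N2.psi32_one_zero, zero_smul]⟩,
    fun t => ⟨fun ht => ?_, N2.psi32_line01 t, N2.delta01_eq t, N2.delta01_isSingular t⟩,
    fun t => ⟨fun ht => ?_, N2.psi32_line10 t, N2.delta10_eq t, N2.delta10_isSingular t⟩,
    N2.psi32Deriv_one_zero, ⟨s01, s10, N2.linearIndependent_delta 1⟩, fun H => ?_⟩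
  · rw [N2.hParam]; field_simp; ring
  · rw [N2.hParam]; field_simp; ring
  · obtain ⟨a, ha⟩ := H _ _ _ _ _ _ _ s01 s10
    -- Proportionality would be a linear relation in which the second vector has coefficient -1.
    have e := LinearIndependent.pair_iff.1 (N2.linearIndependent_delta 1) a (-1)
      (by rw [ha, neg_smul, one_smul, add_neg_cancel])
    exact absurd e.2 (by norm_num)
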